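/- **Conventions.** A *prederivator* is a (pseudo)functor $\mathcal D\colon \mathrm{Cat}^{\mathrm{op}}\to\mathrm{CAT}$ on small categories; morphisms are pseudonatural transformations and 2-cells are modifications. For $u\colon A\to B$ write $u^*\colon\mathcal D(B)\to\mathcal D(A)$. A *derivator* is a prederivator that sends coproducts to products, for which isomorphisms in $\mathcal D(A)$ are detected at the objects of $A$, and for which every $u^*$ has a left adjoint $u_!$ and a right adjoint $u_*$ that are computed by comma squares (Beck–Chevalley). For a morphism $\circledast\colon\mathcal D_1\times\mathcal D_2\to\mathcal D_3$, the external product is $X\circledast Y=\pi_A^*X\circledast\pi_B^*Y\in\mathcal D_3(A\times B)$ for $X\in\mathcal D_1(A)$, $Y\in\mathcal D_2(B)$; $\circledast$ is cocontinuous in each variable if the canonical maps $(u\times 1)_!(X\circledast Y)\to u_!X\circledast Y$ and $(1\times v)_!(X\circledast Y)\to X\circledast v_!Y$ are isomorphisms. It is *part of a two-variable adjunction of derivators* if for all small $A,B$ the external product $\mathcal D_1(A)\times\mathcal D_2(B)\to\mathcal D_3(A\times B)$ is the left adjoint of a two-variable adjunction with right adjoints $\rhd\colon \mathcal D_1(A)^{\mathrm{op}}\times\mathcal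 D_3(A\times B)\to\mathcal D_2(B)$ and $\lhd\colon\mathcal D_3(A\times B)\times\mathcal D_2(B)^{\mathrm{op}}\to\mathcal D_1(A)$, and the canonical maps $v^*(X\rhd Z)\to X\rhd(1\times v)^*Z$ and $u^*(Z\lhd Y)\to (u\times1)^*Z\lhd Y$ are isomorphisms. Let $\mathbf S$ be a category with finite products. An *$\mathbf S$-indexed symmetric monoidal derivator* is a pseudofunctor $\mathcal V$ from $\mathbf S^{\mathrm{op}}$ to the 2-category of symmetric monoidal derivators (derivators with a symmetric monoidal structure whose tensor product is cocontinuous in each variable), cocontinuous strong symmetric monoidal morphisms, and monoidal modifications; write $\mathcal V^R$ for its value at $R$ and $f^*\colon\mathcal V^S\to\mathcal V^R$ for its value at $f\colon R\to S$. It is *closed* if each $\otimes\colon\mathcal V^R\times\mathcal V^R\to\mathcal V^R$ is part of a two-variable adjunction of derivators and, at each small category $A$, the canonical maps $f^*(M\rhd N)\to f^*M\rhd f^*N$ between internal homs are isomorphisms. The *homotopy pullback squares* in $\mathbf S$ are the commutative squares (top, left, right, bottom) of the forms $(f\times 1,\,1\times g,\,1\times g,\,f\times 1)$, $((1,f),\,f,\,f\times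 1,\,\Delta)$, $(\Delta,\,\Delta,\,1\times\Delta,\,\Delta\times1)$, and those obtained from them by taking products with a fixed object. $\mathcal V$ has *indexed homotopy coproducts* (resp. *products*) if each morphism $f^*$ has a left adjoint $f_!$ (resp. right adjoint $f_*$) in the 2-category of derivators and these adjoints satisfy the Beck–Chevalley condition for homotopy pullback squares. **Theorem.** Let $\mathcal V$ be a closed $\mathbf S$-indexed symmetric monoidal derivator with indexed homotopy products and indexed homotopy coproducts. Then the indexed homotopy coproducts are preserved by $\otimes$, that is, the canonical map $f_!(f^*M\otimes N)\to M\otimes f_!N$ is an isomorphism for all $f\colon R\to S$ in $\mathbf S$, all small categories $A$, and all $M\in\mathcal V^S(A)$, $N\in\mathcal V^R(A)$. Moreover, let $\mathcal Di(\mathcal V,\mathbf S)$ be the derivator bicategory with objects those of $\mathbf S$, hom-derivators $\mathcal V^{R\times S}$, composition $$M\odot N=(\mathrm{id}_R\times\pi_S\times\mathrm{id}_T)_!\,(\mathrm{id}_R\times\Delta_S\times\mathrm{id}_T)^*(M\boxtimes N),\qquad M\boxtimes N=\mathrm{pr}_{1}^*M\otimes\mathrm{pr}_{2}^*N,$$ where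 $\mathrm{pr}_1,\mathrm{pr}_2$ are the projections of $(R\times S)\times(S\times T)$ to $R\times S$ and $S\times T$, and units $(\Delta_R)_!\,\pi_R^*(U)$, where $U$ is the monoidal unit of the fiber over the terminal object and $\pi_R$ is the map from $R$ to it. This derivator bicategory is closed: for all $R,S,T$, the composition morphism $\odot\colon\mathcal V^{R\times S}\times\mathcal V^{S\times T}\to\mathcal V^{R\times T}$ is part of a two-variable adjunction of derivators. (This depends only on the objects, hom-derivators and composition morphisms, and so holds for any choice of associativity and unit constraints.) -/

import Mathlib

open CategoryTheory Opposite Bicategory.Opposite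
open scoped Bicategory Pseudofunctor.StrongTrans

universe w v u vS uS

namespace IndexedDerivator

/-! ### Prederivators and derivators

`Cat.{w, w}` is the 2-category of small categories. Its opposite `Cat.{w, w}ᵒᵖ` reverses functors and
keeps the direction of natural transformations. -/

set_option linter.checkUnivs false in
/-- A prederivator: a pseudofunctor from `Catᵒᵖ` to (large) categories. The morphisms of
prederivators are the pseudonatural transformations (`Pseudofunctor.StrongTrans`) and the 2-cells
are the modifications; Mathlib provides this bicategory. -/
abbrev Prederivator := Pseudofunctor (Cat.{w, w})ᵒᵖ Cat.{v, u}

/-- The category `D(A)` of coherent diagrams of shape `A`. -/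
abbrev Diag (D : Prederivator.{w, v, u}) (A : Cat.{w, w}) : Type u := D.obj (op A)

/-- The restriction functor `f^* : D(B) ⥤ D(A)` of `f : A ⟶ B`. -/
abbrev res (D : Prederivator.{w, v, u}) {A B : Cat.{w, w}} (f : A ⟶ B) : Diag D B ⥤ Diag D A :=
  (D.map f.op).toFunctor

/-- The transformation `α^* : f^* ⟶ g^*` of a 2-cell `α : f ⟶ g`. -/
def resMap (D : Prederivator.{w, v, u}) {A B : Cat.{w, w}} {f g : A ⟶ B} (α : f ⟶ g) :
    res D f ⟶ res D g :=
  (D.map₂ (op2 α)).toNatTrans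

/-- The isomorphism `(𝟙 A)^* ≅ 𝟭`. -/
def resId (D : Prederivator.{w, v, u}) (A : Cat.{w, w}) : res D (𝟙 A) ≅ 𝟭 (Diag D A) :=
  Cat.Hom.toNatIso (D.mapId (op A))

/-- The isomorphism `(f ≫ g)^* ≅ f^* g^*`. -/
def resComp (D : Prederivator.{w, v, u}) {A B C : Cat.{w, w}} (f : A ⟶ B) (g : B ⟶ C) :
    res D (f ≫ g) ≅ res D g ⋙ res D f :=
  Cat.Hom.toNatIso (D.mapComp g.op f.op)

/-- The transformation `p^* f^* ⟶ q^* g^*` of a square of small categories filled by a 2-cell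
`α : p ≫ f ⟶ q ≫ g`. -/
def resSquare (D : Prederivator.{w, v, u}) {A B C E : Cat.{w, w}} {p : E ⟶ A} {f : A ⟶ B}
    {q : E ⟶ C} {g : C ⟶ B} (α : p ≫ f ⟶ q ≫ g) :
    TwoSquare (res D f) (res D g) (res D p) (res D q) :=
  (resComp D p f).inv ≫ resMap D α ≫ (resComp D q g).hom

/-- The transformation `p^* ⟶ q^* g^*` of a triangle filled by a 2-cell `α : p ⟶ q ≫ g`. -/
def resTriangle (D : Prederivator.{w, v, u}) {A C E : Cat.{w, w}} {p : E ⟶ A}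
    {q : E ⟶ C} {g : C ⟶ A} (α : p ⟶ q ≫ g) : res D p ⟶ res D g ⋙ res D q :=
  resMap D α ≫ (resComp D q g).hom

/-- The coproduct of a small family of small categories. -/
abbrev sigmaCat {I : Type w} (A : I → Cat.{w, w}) : Cat.{w, w} := Cat.of (Σ i, A i)

/-- The coproduct inclusions. -/
def sigmaIncl {I : Type w} (A : I → Cat.{w, w}) (i : I) : A i ⟶ sigmaCat A :=
  .ofFunctor (Sigma.incl (C := fun i => (A i : Type w)) i)

/-- The terminal small category. -/
def ptCat : Cat.{w, w} := Cat.of (Discrete PUnit.{w + 1})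

/-- The functor from the terminal category that picks the object `a`. -/
def pt {A : Cat.{w, w}} (a : A) : ptCat ⟶ A := .ofFunctor (Functor.fromPUnit a)

section Comma
variable {A B C : Cat.{w, w}} (f : A ⟶ B) (g : C ⟶ B)

/-- The comma category `(f / g)`. -/
def commaCat : Cat.{w, w} := Cat.of (Comma f.toFunctor g.toFunctor)

def commaFst : commaCat f g ⟶ A := .ofFunctor (Comma.fst f.toFunctor g.toFunctor)

def commaSnd : commaCat f g ⟶ C := .ofFunctor (Comma.snd f.toFunctor g.toFunctor)

/-- The universal 2-cell of the comma category. -/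
def commaCell : commaFst f g ≫ f ⟶ commaSnd f g ≫ g :=
  .ofNatTrans (Comma.natTrans f.toFunctor g.toFunctor)
end Comma

/-- The axioms of a derivator: coproducts of small categories go to products; isomorphisms are
detected pointwise; restriction functors have both adjoints (homotopy Kan extensions); homotopy Kan
extensions are computed by comma squares, i.e. the mates
`q_! p^* ⟶ g^* f_!` and `f^* g_* ⟶ p_* q^*` of the comma square of `f` and `g` with projections
`p`, `q` are invertible (for any choice of the adjoints). -/
structure IsDerivator (D : Prederivator.{w, v, u}) : Prop where
  isEquivalence_sigma {I : Type w} (A : I → Cat.{w, w}) :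
    (Functor.pi' fun i => res D (sigmaIncl A i)).IsEquivalence
  isIso_of_pt {A : Cat.{w, w}} {X Y : Diag D A} (φ : X ⟶ Y)
    (h : ∀ a : A, IsIso ((res D (pt a)).map φ)) : IsIso φ
  isRightAdjoint_res {A B : Cat.{w, w}} (f : A ⟶ B) : (res D f).IsRightAdjoint
  isLeftAdjoint_res {A B : Cat.{w, w}} (f : A ⟶ B) : (res D f).IsLeftAdjoint
  isIso_left {A B C : Cat.{w, w}} (f : A ⟶ B) (g : C ⟶ B)
    {L : Diag D A ⥤ Diag D B} (adj : L ⊣ res D f)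
    {L' : Diag D (commaCat f g) ⥤ Diag D C} (adj' : L' ⊣ res D (commaSnd f g)) :
    IsIso ((mateEquiv adj adj').symm (resSquare D (commaCell f g))).natTrans
  isIso_right {A B C : Cat.{w, w}} (f : A ⟶ B) (g : C ⟶ B)
    {R : Diag D C ⥤ Diag D B} (adj : res D g ⊣ R)
    {R' : Diag D (commaCat f g) ⥤ Diag D A} (adj' : res D (commaFst f g) ⊣ R') :
    IsIso (mateEquiv adj adj' (resSquare D (commaCell f g))).natTrans

namespace Prederivator

/-- The product of two prederivators, `(D₁ × D₂)(A) = D₁(A) × D₂(A)`. -/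
def prod (D₁ D₂ : Prederivator.{w, v, u}) : Prederivator.{w, v, u} where
  obj A := Cat.of (D₁.obj A × D₂.obj A)
  map f := .ofFunctor ((D₁.map f).toFunctor.prod (D₂.map f).toFunctor)
  map₂ η := .ofNatTrans (NatTrans.prod (D₁.map₂ η).toNatTrans (D₂.map₂ η).toNatTrans)
  map₂_id f := by
    ext X
    exact Prod.ext congr($(D₁.map₂_id f).toNatTrans.app X.1)
      congr($(D₂.map₂_id f).toNatTrans.app X.2)
  map₂_comp η θ := by
    ext X
    exact Prod.ext congr($(D₁.map₂_comp η θ).toNatTrans.app X.1)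
      congr($(D₂.map₂_comp η θ).toNatTrans.app X.2)
  mapId A := Cat.Hom.isoMk
    (NatIso.prod (Cat.Hom.toNatIso (D₁.mapId A)) (Cat.Hom.toNatIso (D₂.mapId A)))
  mapComp f g := Cat.Hom.isoMk
    (NatIso.prod (Cat.Hom.toNatIso (D₁.mapComp f g)) (Cat.Hom.toNatIso (D₂.mapComp f g)))
  map₂_whisker_left f _ _ η := by
    ext X
    exact Prod.ext congr($(D₁.map₂_whisker_left f η).toNatTrans.app X.1)
      congr($(D₂.map₂_whisker_left f η).toNatTrans.app X.2)
  map₂_whisker_right η h := by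
    ext X
    exact Prod.ext congr($(D₁.map₂_whisker_right η h).toNatTrans.app X.1)
      congr($(D₂.map₂_whisker_right η h).toNatTrans.app X.2)
  map₂_associator f g h := by
    ext X
    exact Prod.ext congr($(D₁.map₂_associator f g h).toNatTrans.app X.1)
      congr($(D₂.map₂_associator f g h).toNatTrans.app X.2)
  map₂_left_unitor f := by
    ext X
    exact Prod.ext congr($(D₁.map₂_left_unitor f).toNatTrans.app X.1)
      congr($(D₂.map₂_left_unitor f).toNatTrans.app X.2)
  map₂_right_unitor f := by
    ext X
    exact Prod.ext congr($(D₁.map₂_right_unitor f).toNatTrans.app X.1)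
      congr($(D₂.map₂_right_unitor f).toNatTrans.app X.2)

/-- The terminal category, with a single object and a single morphism. -/
inductive One : Type u
  | star

instance : Category.{v} One.{u} where
  Hom _ _ := PUnit.{v + 1}
  id _ := ⟨⟩
  comp _ _ := ⟨⟩

/-- The terminal prederivator. -/
def one : Prederivator.{w, v, u} where
  obj _ := Cat.of One.{u}
  map _ := .ofFunctor (𝟭 One.{u})
  map₂ _ := .ofNatTrans (𝟙 (𝟭 One.{u}))
  mapId _ := Iso.refl _
  mapComp _ _ := Iso.refl _
  map₂_id _ := rfl
  map₂_comp _ _ := rfl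
  map₂_whisker_left _ _ _ _ := rfl
  map₂_whisker_right _ _ := rfl
  map₂_associator _ _ _ := rfl
  map₂_left_unitor _ := rfl
  map₂_right_unitor _ := rfl

variable {D₁ D₂ D₃ D₄ E : Prederivator.{w, v, u}}

/-- The first projection. -/
def fst (D₁ D₂ : Prederivator.{w, v, u}) : prod D₁ D₂ ⟶ D₁ where
  app A := .ofFunctor (CategoryTheory.Prod.fst (D₁.obj A) (D₂.obj A))
  naturality f := Cat.Hom.isoMk (Iso.refl _)
  naturality_naturality η := by
    ext X
    exact (Category.comp_id _).trans (Category.id_comp _).symm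
  naturality_id A := by
    ext X
    refine (Category.id_comp ((D₁.mapId A).hom.toNatTrans.app X.1)).trans (Eq.symm ?_)
    change (D₁.mapId A).hom.toNatTrans.app X.1 ≫ 𝟙 _ ≫ 𝟙 _ = _
    simp
  naturality_comp f g := by
    ext X
    refine (Category.id_comp ((D₁.mapComp f g).hom.toNatTrans.app X.1)).trans (Eq.symm ?_)
    change (D₁.mapComp f g).hom.toNatTrans.app X.1 ≫ 𝟙 _ ≫ 𝟙 _ ≫ 𝟙 _ ≫
      (D₁.map g).toFunctor.map (𝟙 _) ≫ 𝟙 _ = _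
    simp

/-- The second projection. -/
def snd (D₁ D₂ : Prederivator.{w, v, u}) : prod D₁ D₂ ⟶ D₂ where
  app A := .ofFunctor (CategoryTheory.Prod.snd (D₁.obj A) (D₂.obj A))
  naturality f := Cat.Hom.isoMk (Iso.refl _)
  naturality_naturality η := by
    ext X
    exact (Category.comp_id _).trans (Category.id_comp _).symm
  naturality_id A := by
    ext X
    refine (Category.id_comp ((D₂.mapId A).hom.toNatTrans.app X.2)).trans (Eq.symm ?_)
    change (D₂.mapId A).hom.toNatTrans.app X.2 ≫ 𝟙 _ ≫ 𝟙 _ = _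
    simp
  naturality_comp f g := by
    ext X
    refine (Category.id_comp ((D₂.mapComp f g).hom.toNatTrans.app X.2)).trans (Eq.symm ?_)
    change (D₂.mapComp f g).hom.toNatTrans.app X.2 ≫ 𝟙 _ ≫ 𝟙 _ ≫ 𝟙 _ ≫
      (D₂.map g).toFunctor.map (𝟙 _) ≫ 𝟙 _ = _
    simp

/-- The morphism into a product with given components. -/
def lift (F : E ⟶ D₁) (G : E ⟶ D₂) : E ⟶ prod D₁ D₂ where
  app A := .ofFunctor (Functor.prod' (F.app A).toFunctor (G.app A).toFunctor)
  naturality f := Cat.Hom.isoMk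
    (NatIso.ofComponents
      (fun X => Iso.prod ((Cat.Hom.toNatIso (F.naturality f)).app X)
        ((Cat.Hom.toNatIso (G.naturality f)).app X))
      (fun φ => Prod.ext ((F.naturality f).hom.toNatTrans.naturality φ)
        ((G.naturality f).hom.toNatTrans.naturality φ)))
  naturality_naturality η := by
    ext X
    exact Prod.ext congr($(F.naturality_naturality η).toNatTrans.app X)
      congr($(G.naturality_naturality η).toNatTrans.app X)
  naturality_id A := by
    ext X
    exact Prod.ext congr($(F.naturality_id A).toNatTrans.app X)
      congr($(G.naturality_id A).toNatTrans.app X)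
  naturality_comp f g := by
    ext X
    exact Prod.ext congr($(F.naturality_comp f g).toNatTrans.app X)
      congr($(G.naturality_comp f g).toNatTrans.app X)

/-- The morphism to the terminal prederivator. -/
def toOne (E : Prederivator.{w, v, u}) : E ⟶ one where
  app _ := .ofFunctor ((Functor.const _).obj One.star)
  naturality _ := Iso.refl _
  naturality_naturality _ := rfl
  naturality_id _ := rfl
  naturality_comp _ _ := rfl

/-- The product of two morphisms. -/
def map {D₁ D₂ D₃ D₄ : Prederivator.{w, v, u}} (F : D₁ ⟶ D₃) (G : D₂ ⟶ D₄) :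
    prod D₁ D₂ ⟶ prod D₃ D₄ :=
  lift (fst D₁ D₂ ≫ F) (snd D₁ D₂ ≫ G)

/-- The reassociation morphism. -/
def assoc (D₁ D₂ D₃ : Prederivator.{w, v, u}) :
    prod (prod D₁ D₂) D₃ ⟶ prod D₁ (prod D₂ D₃) :=
  lift (fst _ _ ≫ fst _ _) (lift (fst _ _ ≫ snd _ _) (snd _ _))

end Prederivator

open MonoidalCategory

/-! ### Symmetric monoidal prederivators -/

/-- A symmetric monoidal prederivator: a pseudofunctor from `Catᵒᵖ` to the 2-category of symmetric
monoidal categories, strong symmetric monoidal functors and monoidal transformations. -/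
class SymmetricMonoidalStructure (D : Prederivator.{w, v, u}) where
  monoidal (A : Cat.{w, w}) : MonoidalCategory (Diag D A)
  symmetric (A : Cat.{w, w}) : SymmetricCategory (Diag D A)
  braided {A B : Cat.{w, w}} (f : A ⟶ B) : (res D f).Braided
  isMonoidal_resMap {A B : Cat.{w, w}} {f g : A ⟶ B} (α : f ⟶ g) :
    NatTrans.IsMonoidal (resMap D α)
  isMonoidal_resId (A : Cat.{w, w}) : NatTrans.IsMonoidal (resId D A).hom
  isMonoidal_resComp {A B C : Cat.{w, w}} (f : A ⟶ B) (g : B ⟶ C) :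
    NatTrans.IsMonoidal (resComp D f g).hom

attribute [reducible, instance] SymmetricMonoidalStructure.monoidal
  SymmetricMonoidalStructure.symmetric SymmetricMonoidalStructure.braided

attribute [instance] SymmetricMonoidalStructure.isMonoidal_resMap
  SymmetricMonoidalStructure.isMonoidal_resId SymmetricMonoidalStructure.isMonoidal_resComp

open Functor.LaxMonoidal Functor.Monoidal

/-- The tensor product of a symmetric monoidal prederivator, as a morphism `D × D ⟶ D`. -/
def tensorMor (D : Prederivator.{w, v, u}) [SymmetricMonoidalStructure D] :
    Prederivator.prod D D ⟶ D where
  app A := .ofFunctor (tensor (Diag D A.unop))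
  naturality {A B} f := Cat.Hom.isoMk
    (F := (res D f.unop).prod (res D f.unop) ⋙ tensor (Diag D B.unop))
    (G := tensor (Diag D A.unop) ⋙ res D f.unop)
    (NatIso.ofComponents (fun X => μIso (res D f.unop) X.1 X.2) (fun φ => by
      exact μ_natural (res D f.unop) φ.1 φ.2))
  naturality_naturality {A B f g} η := by
    ext X
    exact (NatTrans.IsMonoidal.tensor (τ := resMap D η.unop2) X.1 X.2).symm
  naturality_id A := by
    ext X
    refine (NatTrans.IsMonoidal.tensor (τ := (resId D A.unop).hom) X.1 X.2).trans ?_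
    change ((resId D A.unop).hom.app X.1 ⊗ₘ (resId D A.unop).hom.app X.2) ≫ 𝟙 _ =
      ((resId D A.unop).hom.app X.1 ⊗ₘ (resId D A.unop).hom.app X.2) ≫ 𝟙 _ ≫ 𝟙 _
    simp
  naturality_comp f g := by
    ext X
    refine (NatTrans.IsMonoidal.tensor (τ := (resComp D g.unop f.unop).hom) X.1 X.2).trans ?_
    change ((resComp D g.unop f.unop).hom.app X.1 ⊗ₘ (resComp D g.unop f.unop).hom.app X.2) ≫
        μ (res D g.unop) _ _ ≫ (res D g.unop).map (μ (res D f.unop) _ _) =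
      ((resComp D g.unop f.unop).hom.app X.1 ⊗ₘ (resComp D g.unop f.unop).hom.app X.2) ≫ 𝟙 _ ≫
        μ (res D g.unop) _ _ ≫ 𝟙 _ ≫ (res D g.unop).map (μ (res D f.unop) _ _) ≫ 𝟙 _
    simp

/-- The tensor unit of a symmetric monoidal prederivator, as a morphism `1 ⟶ D`. -/
def unitMor (D : Prederivator.{w, v, u}) [SymmetricMonoidalStructure D] :
    Prederivator.one ⟶ D where
  app A := .ofFunctor ((Functor.const _).obj (𝟙_ (Diag D A.unop)))
  naturality {A B} f := Cat.Hom.isoMk (F := 𝟭 _ ⋙ (Functor.const _).obj (𝟙_ (Diag D B.unop)))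
    (G := (Functor.const _).obj (𝟙_ (Diag D A.unop)) ⋙ res D f.unop)
    (NatIso.ofComponents (fun X => εIso (res D f.unop)) (fun φ =>
      (Category.id_comp _).trans ((res D f.unop).map_id _ ▸ Category.comp_id _).symm))
  naturality_naturality {A B f g} η := by
    ext X
    refine (Category.id_comp _).trans ?_
    exact (NatTrans.IsMonoidal.unit (τ := resMap D η.unop2)).symm
  naturality_id A := by
    ext X
    refine (NatTrans.IsMonoidal.unit (τ := (resId D A.unop).hom)).trans ?_
    change 𝟙 _ = 𝟙 _ ≫ 𝟙 _ ≫ 𝟙 _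
    simp
  naturality_comp f g := by
    ext X
    refine (NatTrans.IsMonoidal.unit (τ := (resComp D g.unop f.unop).hom)).trans ?_
    change Functor.LaxMonoidal.ε (res D g.unop) ≫
        (res D g.unop).map (Functor.LaxMonoidal.ε (res D f.unop)) =
      𝟙 _ ≫ 𝟙 _ ≫ Functor.LaxMonoidal.ε (res D g.unop) ≫ 𝟙 _ ≫
        (res D g.unop).map (Functor.LaxMonoidal.ε (res D f.unop)) ≫ 𝟙 _
    simp

/-! ### Two-variable morphisms, cocontinuity and two-variable adjunctions -/

section External

/-- The product of two small categories. -/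
def prodCat (A B : Cat.{w, w}) : Cat.{w, w} := Cat.of (A × B)

def prodFst (A B : Cat.{w, w}) : prodCat A B ⟶ A := .ofFunctor (CategoryTheory.Prod.fst A B)

def prodSnd (A B : Cat.{w, w}) : prodCat A B ⟶ B := .ofFunctor (CategoryTheory.Prod.snd A B)

def prodMap {A A' B B' : Cat.{w, w}} (f : A ⟶ A') (g : B ⟶ B') : prodCat A B ⟶ prodCat A' B' :=
  .ofFunctor (f.toFunctor.prod g.toFunctor)

variable {D₁ D₂ D₃ : Prederivator.{w, v, u}}

/-- `(X, Y) ↦ π_A^* X ⊛ π_B^* Y`, as a functor on the product category. -/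
def externalUncurried (F : Prederivator.prod D₁ D₂ ⟶ D₃) (A B : Cat.{w, w}) :
    Diag D₁ A × Diag D₂ B ⥤ Diag D₃ (prodCat A B) :=
  (res D₁ (prodFst A B)).prod (res D₂ (prodSnd A B)) ⋙ (F.app (op (prodCat A B))).toFunctor

/-- The external version of a two-variable morphism `F = ⊛`, the bifunctor
`D₁(A) × D₂(B) ⥤ D₃(A × B)` with `(X, Y) ↦ π_A^* X ⊛ π_B^* Y`. -/
def external (F : Prederivator.prod D₁ D₂ ⟶ D₃) (A B : Cat.{w, w}) :
    Diag D₁ A ⥤ Diag D₂ B ⥤ Diag D₃ (prodCat A B) :=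
  Functor.curry.obj (externalUncurried F A B)

/-- The naturality square `F_A f^* ⟶ f^* F_B` of a morphism `F` of prederivators. -/
def morNat {D E : Prederivator.{w, v, u}} (F : D ⟶ E) {A B : Cat.{w, w}} (f : A ⟶ B) :
    TwoSquare (res D f) (F.app (op B)).toFunctor (F.app (op A)).toFunctor (res E f) :=
  (F.naturality f.op).hom.toNatTrans

/-- The (invertible) transformation from `(X, Y) ↦ X ⊛ g^* Y` to `(X, Y) ↦ (A × g)^* (X ⊛ Y)`. -/
def externalNatRight (F : Prederivator.prod D₁ D₂ ⟶ D₃) (A : Cat.{w, w})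
    {B B' : Cat.{w, w}} (g : B ⟶ B') :
    (𝟭 (Diag D₁ A)).prod (res D₂ g) ⋙ externalUncurried F A B ⟶
      externalUncurried F A B' ⋙ res D₃ (prodMap (𝟙 A) g) :=
  Functor.whiskerRight
      (NatTrans.prod
        (resTriangle D₁ (p := prodFst A B) (q := prodMap (𝟙 A) g) (g := prodFst A B') (𝟙 _))
        (resSquare D₂ (p := prodSnd A B) (f := g) (q := prodMap (𝟙 A) g) (g := prodSnd A B')
          (𝟙 _)).natTrans)
      (F.app (op (prodCat A B))).toFunctor ≫
    Functor.whiskerLeft ((res D₁ (prodFst A B')).prod (res D₂ (prodSnd A B')))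
      (morNat F (prodMap (𝟙 A) g)).natTrans

/-- The (invertible) transformation from `(X, Y) ↦ f^* X ⊛ Y` to `(X, Y) ↦ (f × B)^* (X ⊛ Y)`. -/
def externalNatLeft (F : Prederivator.prod D₁ D₂ ⟶ D₃) {A A' : Cat.{w, w}} (f : A ⟶ A')
    (B : Cat.{w, w}) :
    (res D₁ f).prod (𝟭 (Diag D₂ B)) ⋙ externalUncurried F A B ⟶
      externalUncurried F A' B ⋙ res D₃ (prodMap f (𝟙 B)) :=
  Functor.whiskerRight
      (NatTrans.prod
        (resSquare D₁ (p := prodFst A B) (f := f) (q := prodMap f (𝟙 B)) (g := prodFst A' B)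
          (𝟙 _)).natTrans
        (resTriangle D₂ (p := prodSnd A B) (q := prodMap f (𝟙 B)) (g := prodSnd A' B) (𝟙 _)))
      (F.app (op (prodCat A B))).toFunctor ≫
    Functor.whiskerLeft ((res D₁ (prodFst A' B)).prod (res D₂ (prodSnd A' B)))
      (morNat F (prodMap f (𝟙 B))).natTrans

/-- `externalNatRight` with `X` fixed. -/
def externalSquareRight (F : Prederivator.prod D₁ D₂ ⟶ D₃) {A : Cat.{w, w}} (X : Diag D₁ A)
    {B B' : Cat.{w, w}} (g : B ⟶ B') :
    TwoSquare (res D₂ g) ((external F A B').obj X) ((external F A B).obj X)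
      (res D₃ (prodMap (𝟙 A) g)) :=
  Functor.whiskerLeft (CategoryTheory.Prod.sectR X (Diag D₂ B')) (externalNatRight F A g)

/-- `externalNatLeft` with `Y` fixed. -/
def externalSquareLeft (F : Prederivator.prod D₁ D₂ ⟶ D₃) {A A' : Cat.{w, w}} (f : A ⟶ A')
    {B : Cat.{w, w}} (Y : Diag D₂ B) :
    TwoSquare (res D₁ f) ((external F A' B).flip.obj Y) ((external F A B).flip.obj Y)
      (res D₃ (prodMap f (𝟙 B))) :=
  Functor.whiskerLeft (CategoryTheory.Prod.sectL (Diag D₁ A') Y) (externalNatLeft F f B)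

/-- A morphism of derivators is cocontinuous if it preserves left homotopy Kan extensions: the mates
`f_! F_A ⟶ F_B f_!` are invertible. -/
def IsCocontinuous {D E : Prederivator.{w, v, u}} (F : D ⟶ E) : Prop :=
  ∀ {A B : Cat.{w, w}} (f : A ⟶ B) {L : Diag D A ⥤ Diag D B} (adj : L ⊣ res D f)
    {L' : Diag E A ⥤ Diag E B} (adj' : L' ⊣ res E f),
    IsIso ((mateEquiv adj adj').symm (morNat F f)).natTrans

/-- A two-variable morphism of derivators is cocontinuous in each variable separately: the mates
`(f × B)_! (X ⊛ Y) ⟶ f_! X ⊛ Y` and `(A × g)_! (X ⊛ Y) ⟶ X ⊛ g_! Y` for the external product are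
invertible. -/
structure IsCocontinuousInEach (F : Prederivator.prod D₁ D₂ ⟶ D₃) : Prop where
  left {A A' : Cat.{w, w}} (f : A ⟶ A') {B : Cat.{w, w}} (Y : Diag D₂ B)
    {L : Diag D₁ A ⥤ Diag D₁ A'} (adj : L ⊣ res D₁ f)
    {L' : Diag D₃ (prodCat A B) ⥤ Diag D₃ (prodCat A' B)}
    (adj' : L' ⊣ res D₃ (prodMap f (𝟙 B))) :
    IsIso ((mateEquiv adj adj').symm (externalSquareLeft F f Y)).natTrans
  right {A : Cat.{w, w}} (X : Diag D₁ A) {B B' : Cat.{w, w}} (g : B ⟶ B')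
    {L : Diag D₂ B ⥤ Diag D₂ B'} (adj : L ⊣ res D₂ g)
    {L' : Diag D₃ (prodCat A B) ⥤ Diag D₃ (prodCat A B')}
    (adj' : L' ⊣ res D₃ (prodMap (𝟙 A) g)) :
    IsIso ((mateEquiv adj adj').symm (externalSquareRight F X g)).natTrans

/-- A two-variable adjunction of derivators with left adjoint the two-variable morphism `F = ⊛`:
for all `A`, `B`, the external product `D₁(A) × D₂(B) ⥤ D₃(A × B)` is the left adjoint of an
adjunction of two variables, with right adjoints
`▷ : D₁(A)ᵒᵖ × D₃(A × B) ⥤ D₂(B)` and `◁ : D₃(A × B) × D₂(B)ᵒᵖ ⥤ D₁(A)`, and these are pseudonatural: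
the mates `g^* (X ▷ Z) ⟶ X ▷ (A × g)^* Z` and `f^* (Z ◁ Y) ⟶ (f × B)^* Z ◁ Y` are invertible. -/
structure TwoVariableAdjunction (F : Prederivator.prod D₁ D₂ ⟶ D₃) where
  homRight (A B : Cat.{w, w}) : (Diag D₁ A)ᵒᵖ ⥤ Diag D₃ (prodCat A B) ⥤ Diag D₂ B
  homLeft (A B : Cat.{w, w}) : (Diag D₂ B)ᵒᵖ ⥤ Diag D₃ (prodCat A B) ⥤ Diag D₁ A
  adjRight (A B : Cat.{w, w}) : external F A B ⊣₂ homRight A B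
  adjLeft (A B : Cat.{w, w}) : (external F A B).flip ⊣₂ homLeft A B
  isIso_right {A : Cat.{w, w}} (X : Diag D₁ A) {B B' : Cat.{w, w}} (g : B ⟶ B') :
    IsIso (mateEquiv ((adjRight A B').adj X) ((adjRight A B).adj X)
      (externalSquareRight F X g)).natTrans
  isIso_left {A A' : Cat.{w, w}} (f : A ⟶ A') {B : Cat.{w, w}} (Y : Diag D₂ B) :
    IsIso (mateEquiv ((adjLeft A' B).adj Y) ((adjLeft A B).adj Y)
      (externalSquareLeft F f Y)).natTrans

end External

/-! ### Derivator bicategories -/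

set_option linter.checkUnivs false in
/-- The objects, hom-derivators, composition morphisms and units of a derivator bicategory. -/
structure DerivatorBicategoryData where
  Obj : Type uS
  hom : Obj → Obj → Prederivator.{w, v, u}
  isDerivator_hom (R S : Obj) : IsDerivator (hom R S)
  comp (R S T : Obj) : Prederivator.prod (hom R S) (hom S T) ⟶ hom R T
  unit (R : Obj) : Prederivator.one ⟶ hom R R

namespace DerivatorBicategoryData

variable (W : DerivatorBicategoryData.{w, v, u, uS})

/-- A derivator bicategory is closed if each composition morphism participates in a two-variable
adjunction of derivators. -/
def IsClosed : Prop :=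
  ∀ R S T : W.Obj, Nonempty (TwoVariableAdjunction (W.comp R S T))

/-- The composition functors at the shape `A`. -/
abbrev compFunctor (R S T : W.Obj) (A : Cat.{w, w}) :
    Diag (W.hom R S) A × Diag (W.hom S T) A ⥤ Diag (W.hom R T) A :=
  ((W.comp R S T).app (op A)).toFunctor

/-- The unit object at the shape `A`. -/
abbrev unitObj (R : W.Obj) (A : Cat.{w, w}) : Diag (W.hom R R) A :=
  ((W.unit R).app (op A)).toFunctor.obj Prederivator.One.star

/-- Associativity isomorphisms: invertible modifications `(M ⊙ N) ⊙ P ≅ M ⊙ (N ⊙ P)`. -/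
abbrev Associator : Type _ := ∀ R S T U : W.Obj,
    Prederivator.map (W.comp R S T) (𝟙 (W.hom T U)) ≫ W.comp R T U ≅
      Prederivator.assoc (W.hom R S) (W.hom S T) (W.hom T U) ≫
        Prederivator.map (𝟙 (W.hom R S)) (W.comp S T U) ≫ W.comp R S U

/-- Right unit isomorphisms: invertible modifications `M ⊙ I ≅ M`. -/
abbrev RightUnitor : Type _ := ∀ R S : W.Obj,
    Prederivator.lift (𝟙 (W.hom R S)) (Prederivator.toOne _ ≫ W.unit S) ≫ W.comp R S S ≅
      𝟙 (W.hom R S)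

/-- Left unit isomorphisms: invertible modifications `I ⊙ M ≅ M`. -/
abbrev LeftUnitor : Type _ := ∀ R S : W.Obj,
    Prederivator.lift (Prederivator.toOne _ ≫ W.unit R) (𝟙 (W.hom R S)) ≫ W.comp R R S ≅
      𝟙 (W.hom R S)

variable {W}

/-- The components of the associativity isomorphism. -/
def associatorHom (a : W.Associator) {R S T U : W.Obj} {A : Cat.{w, w}} (M : Diag (W.hom R S) A)
    (N : Diag (W.hom S T) A) (P : Diag (W.hom T U) A) :
    (W.compFunctor R T U A).obj ((W.compFunctor R S T A).obj (M, N), P) ⟶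
      (W.compFunctor R S U A).obj (M, (W.compFunctor S T U A).obj (N, P)) :=
  ((a R S T U).hom.as.app (op A)).toNatTrans.app ((M, N), P)

/-- The components of the right unit isomorphism. -/
def rightUnitorHom (r : W.RightUnitor) {R S : W.Obj} {A : Cat.{w, w}} (M : Diag (W.hom R S) A) :
    (W.compFunctor R S S A).obj (M, W.unitObj S A) ⟶ M :=
  ((r R S).hom.as.app (op A)).toNatTrans.app M

/-- The components of the left unit isomorphism. -/
def leftUnitorHom (l : W.LeftUnitor) {R S : W.Obj} {A : Cat.{w, w}} (M : Diag (W.hom R S) A) :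
    (W.compFunctor R R S A).obj (W.unitObj R A, M) ⟶ M :=
  ((l R S).hom.as.app (op A)).toNatTrans.app M

end DerivatorBicategoryData

set_option linter.checkUnivs false in
/-- A derivator bicategory: composition is cocontinuous in each variable, and there are invertible
associativity and unit modifications that satisfy the pentagon and triangle axioms. -/
structure DerivatorBicategory extends DerivatorBicategoryData.{w, v, u, uS} where
  isCocontinuousInEach_comp (R S T : Obj) : IsCocontinuousInEach (comp R S T)
  associator : toDerivatorBicategoryData.Associator
  rightUnitor : toDerivatorBicategoryData.RightUnitor
  leftUnitor : toDerivatorBicategoryData.LeftUnitor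
  pentagon {R S T U Q : Obj} {A : Cat.{w, w}} (M : Diag (hom R S) A) (N : Diag (hom S T) A)
    (P : Diag (hom T U) A) (K : Diag (hom U Q) A) :
    (toDerivatorBicategoryData.compFunctor R U Q A).map
        ((DerivatorBicategoryData.associatorHom associator M N P, 𝟙 K) :
          (_, K) ⟶ (_, K)) ≫
      DerivatorBicategoryData.associatorHom associator M
        ((toDerivatorBicategoryData.compFunctor S T U A).obj (N, P)) K ≫
      (toDerivatorBicategoryData.compFunctor R S Q A).map
        ((𝟙 M, DerivatorBicategoryData.associatorHom associator N P K) :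
          (M, _) ⟶ (M, _)) =
    DerivatorBicategoryData.associatorHom associator
        ((toDerivatorBicategoryData.compFunctor R S T A).obj (M, N)) P K ≫
      DerivatorBicategoryData.associatorHom associator M N
        ((toDerivatorBicategoryData.compFunctor T U Q A).obj (P, K))
  triangle {R S T : Obj} {A : Cat.{w, w}} (M : Diag (hom R S) A) (N : Diag (hom S T) A) :
    DerivatorBicategoryData.associatorHom associator M
        (toDerivatorBicategoryData.unitObj S A) N ≫
      (toDerivatorBicategoryData.compFunctor R S T A).map
        ((𝟙 M, DerivatorBicategoryData.leftUnitorHom leftUnitor N) : (M, _) ⟶ (M, N)) =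
    (toDerivatorBicategoryData.compFunctor R S T A).map
      ((DerivatorBicategoryData.rightUnitorHom rightUnitor M, 𝟙 N) : (_, N) ⟶ (M, N))

/-! ### Indexed derivators -/

open Limits

section Indexed

variable (S : Type uS) [Category.{vS} S]

set_option linter.checkUnivs false in
/-- An `S`-indexed prederivator: a pseudofunctor from `Sᵒᵖ` to the 2-category of prederivators. -/
abbrev IndexedPrederivator :=
  Pseudofunctor (LocallyDiscrete Sᵒᵖ) (Prederivator.{w, v, u})

end Indexed

namespace IndexedPrederivator

variable {S : Type uS} [Category.{vS} S] (V : IndexedPrederivator.{w, v, u} S)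

/-- The fiber `V^R`. -/
abbrev fiber (R : S) : Prederivator.{w, v, u} := V.obj ⟨op R⟩

/-- The reindexing morphism `f^* : V^T ⟶ V^R`. -/
abbrev pb {R T : S} (f : R ⟶ T) : V.fiber T ⟶ V.fiber R := V.map f.op.toLoc

/-- The reindexing functor `f^* : V^T(A) ⥤ V^R(A)`. -/
abbrev pbAt {R T : S} (f : R ⟶ T) (A : Cat.{w, w}) : Diag (V.fiber T) A ⥤ Diag (V.fiber R) A :=
  ((V.pb f).app (op A)).toFunctor

/-- The isomorphism `(𝟙 R)^* ≅ 𝟭` at the shape `A`. -/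
def pbAtId (R : S) (A : Cat.{w, w}) : V.pbAt (𝟙 R) A ⟶ 𝟭 (Diag (V.fiber R) A) :=
  ((V.mapId ⟨op R⟩).hom.as.app (op A)).toNatTrans

/-- The isomorphism `(f ≫ g)^* ≅ f^* g^*` at the shape `A`. -/
def pbAtComp {R T U : S} (f : R ⟶ T) (g : T ⟶ U) (A : Cat.{w, w}) :
    V.pbAt (f ≫ g) A ⟶ V.pbAt g A ⋙ V.pbAt f A :=
  ((V.mapComp g.op.toLoc f.op.toLoc).hom.as.app (op A)).toNatTrans

/-- The isomorphism `h^* k^* ≅ f^* g^*` of a commutative square. -/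
def pbSquare {A B C D : S} {f : A ⟶ B} {h : A ⟶ C} {g : B ⟶ D} {k : C ⟶ D}
    (sq : CommSq f h g k) : V.pb k ≫ V.pb h ≅ V.pb g ≫ V.pb f :=
  V.isoMapOfCommSq ⟨by
    rw [← Quiver.Hom.comp_toLoc, ← Quiver.Hom.comp_toLoc, ← op_comp, ← op_comp, sq.w]⟩
end IndexedPrederivator

section HomotopyProductsAndCoproducts

/-- The homotopy pullback squares of a category with finite products. In
`IsHomotopyPullbackSquare f h g k` the morphisms are the top `f : A ⟶ B`, left `h : A ⟶ C`,
right `g : B ⟶ D` and bottom `k : C ⟶ D` sides of a commutative square. There are three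
basic forms, and one may take products with a fixed object. -/
inductive IsHomotopyPullbackSquare {S : Type uS} [Category.{vS} S] [HasFiniteProducts S] :
    ∀ {A B C D : S}, (A ⟶ B) → (A ⟶ C) → (B ⟶ D) → (C ⟶ D) → Prop
  | prod {A B C D : S} (f : A ⟶ B) (g : C ⟶ D) :
      IsHomotopyPullbackSquare (prod.map f (𝟙 C)) (prod.map (𝟙 A) g) (prod.map (𝟙 B) g)
        (prod.map f (𝟙 D))
  | graph {A B : S} (f : A ⟶ B) :
      IsHomotopyPullbackSquare (prod.lift (𝟙 A) f) f (prod.map f (𝟙 B)) (diag B)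
  | diag (A : S) :
      IsHomotopyPullbackSquare (diag A) (diag A) (prod.map (𝟙 A) (diag A))
        (prod.map (diag A) (𝟙 A) ≫ (prod.associator A A A).hom)
  | prodLeft (X : S) {A B C D : S} {f : A ⟶ B} {h : A ⟶ C} {g : B ⟶ D} {k : C ⟶ D}
      (sq : IsHomotopyPullbackSquare f h g k) :
      IsHomotopyPullbackSquare (prod.map (𝟙 X) f) (prod.map (𝟙 X) h) (prod.map (𝟙 X) g)
        (prod.map (𝟙 X) k)
  | prodRight (X : S) {A B C D : S} {f : A ⟶ B} {h : A ⟶ C} {g : B ⟶ D} {k : C ⟶ D}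
      (sq : IsHomotopyPullbackSquare f h g k) :
      IsHomotopyPullbackSquare (prod.map f (𝟙 X)) (prod.map h (𝟙 X)) (prod.map g (𝟙 X))
        (prod.map k (𝟙 X))

variable {S : Type uS} [Category.{vS} S] [HasFiniteProducts S]

theorem IsHomotopyPullbackSquare.commSq {A B C D : S} {f : A ⟶ B} {h : A ⟶ C} {g : B ⟶ D}
    {k : C ⟶ D} (sq : IsHomotopyPullbackSquare f h g k) : CommSq f h g k := by
  induction sq with
  | prod f g => exact ⟨by simp⟩
  | graph f => exact ⟨by simp⟩
  | diag A =>
    refine ⟨?_⟩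
    have h₁ : Limits.diag A ≫ Limits.prod.fst = 𝟙 A := Limits.prod.lift_fst _ _
    have h₂ : Limits.diag A ≫ Limits.prod.snd = 𝟙 A := Limits.prod.lift_snd _ _
    simp only [Limits.prod.associator_hom, Limits.prod.comp_lift, Limits.prod.lift_map,
      Limits.diag, Limits.prod.map_fst_assoc, Limits.prod.map_snd, Category.comp_id] at *
    simp only [h₁, h₂, Category.comp_id]
  | prodLeft X _ ih => exact ⟨by simp [ih.w]⟩
  | prodRight X _ ih => exact ⟨by simp [ih.w]⟩

/-- Indexed homotopy coproducts: each `f^*` has a left adjoint `f_!` in the 2-category of derivators,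
and `f_! h^* ⟶ g^* k_!` is invertible for homotopy pullback squares. -/
structure IndexedHomotopyCoproducts (V : IndexedPrederivator.{w, v, u} S) where
  push {A B : S} (f : A ⟶ B) : V.fiber A ⟶ V.fiber B
  adj {A B : S} (f : A ⟶ B) : Bicategory.Adjunction (push f) (V.pb f)
  beckChevalley {A B C D : S} {f : A ⟶ B} {h : A ⟶ C} {g : B ⟶ D} {k : C ⟶ D}
    (sq : IsHomotopyPullbackSquare f h g k) :
    IsIso ((Bicategory.mateEquiv (adj k) (adj f)).symm (V.pbSquare sq.commSq).hom)

/-- Indexed homotopy products: each `f^*` has a right adjoint `f_*` in the 2-category of derivators,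
and `k^* g_* ⟶ h_* f^*` is invertible for homotopy pullback squares. -/
structure IndexedHomotopyProducts (V : IndexedPrederivator.{w, v, u} S) where
  copush {A B : S} (f : A ⟶ B) : V.fiber A ⟶ V.fiber B
  adj {A B : S} (f : A ⟶ B) : Bicategory.Adjunction (V.pb f) (copush f)
  beckChevalley {A B C D : S} {f : A ⟶ B} {h : A ⟶ C} {g : B ⟶ D} {k : C ⟶ D}
    (sq : IsHomotopyPullbackSquare f h g k) :
    IsIso (Bicategory.mateEquiv (adj g) (adj h) (V.pbSquare sq.commSq).hom)

end HomotopyProductsAndCoproducts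

/-- A symmetric monoidal derivator: a derivator with a symmetric monoidal structure whose tensor
product is cocontinuous in each variable. -/
class SymmetricMonoidalDerivator (D : Prederivator.{w, v, u}) extends
    SymmetricMonoidalStructure D where
  isDerivator : IsDerivator D
  isCocontinuousInEach_tensor : IsCocontinuousInEach (tensorMor D)

set_option linter.checkUnivs false in
/-- An `S`-indexed symmetric monoidal derivator: a pseudofunctor from `Sᵒᵖ` to the 2-category of
symmetric monoidal derivators, cocontinuous strong symmetric monoidal morphisms, and monoidal
modifications. -/
structure IndexedSymmetricMonoidalDerivator (S : Type uS) [Category.{vS} S] where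
  toPseudofunctor : IndexedPrederivator.{w, v, u} S
  monoidal (R : S) : SymmetricMonoidalDerivator (toPseudofunctor.fiber R)
  isCocontinuous_pb {R T : S} (f : R ⟶ T) : IsCocontinuous (toPseudofunctor.pb f)
  braided_pb {R T : S} (f : R ⟶ T) (A : Cat.{w, w}) : (toPseudofunctor.pbAt f A).Braided
  isMonoidal_pb {R T : S} (f : R ⟶ T) {A B : Cat.{w, w}} (g : A ⟶ B) :
    NatTrans.IsMonoidal (F₁ := res (toPseudofunctor.fiber T) g ⋙ toPseudofunctor.pbAt f A)
      (F₂ := toPseudofunctor.pbAt f B ⋙ res (toPseudofunctor.fiber R) g)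
      (morNat (toPseudofunctor.pb f) g).natTrans
  isMonoidal_pbAtId (R : S) (A : Cat.{w, w}) :
    NatTrans.IsMonoidal (toPseudofunctor.pbAtId R A)
  isMonoidal_pbAtComp {R T U : S} (f : R ⟶ T) (g : T ⟶ U) (A : Cat.{w, w}) :
    NatTrans.IsMonoidal (toPseudofunctor.pbAtComp f g A)


attribute [instance] IndexedSymmetricMonoidalDerivator.monoidal
attribute [instance] IndexedSymmetricMonoidalDerivator.braided_pb

namespace IndexedSymmetricMonoidalDerivator

section Closed

variable {S : Type uS} [Category.{vS} S] (V : IndexedSymmetricMonoidalDerivator.{w, v, u} S)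

abbrev fiber (R : S) : Prederivator.{w, v, u} := V.toPseudofunctor.fiber R

abbrev pb {R T : S} (f : R ⟶ T) : V.fiber T ⟶ V.fiber R := V.toPseudofunctor.pb f

abbrev pbAt {R T : S} (f : R ⟶ T) (A : Cat.{w, w}) : Diag (V.fiber T) A ⥤ Diag (V.fiber R) A :=
  V.toPseudofunctor.pbAt f A

/-- The isomorphism `f^* X ⊗ f^* M ⟶ f^* (X ⊗ M)`, natural in `X`. -/
def pbTensorRight {R T : S} (f : R ⟶ T) (A : Cat.{w, w}) (M : Diag (V.fiber T) A) :
    TwoSquare (V.pbAt f A) (tensorRight M) (tensorRight ((V.pbAt f A).obj M)) (V.pbAt f A) where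
  app X := μ (V.pbAt f A) X M
  naturality _ _ φ := μ_natural_left (V.pbAt f A) φ M

/-- `V` is closed if each `V^R` is closed, i.e. its tensor product is part of a two-variable
adjunction of derivators, and each `f^*` is closed monoidal: at each shape `A`, the mate
`f^* (M ▷ N) ⟶ f^* M ▷ f^* N` of `f^* X ⊗ f^* M ≅ f^* (X ⊗ M)` is invertible, where
`M ▷ -` and `f^* M ▷ -` are (any) right adjoints of `- ⊗ M` and `- ⊗ f^* M`. -/
structure IsClosed : Prop where
  closed_fiber (R : S) : Nonempty (TwoVariableAdjunction (tensorMor (V.fiber R)))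
  closed_pb {R T : S} (f : R ⟶ T) (A : Cat.{w, w}) (M : Diag (V.fiber T) A)
    {H : Diag (V.fiber T) A ⥤ Diag (V.fiber T) A} (adj : tensorRight M ⊣ H)
    {H' : Diag (V.fiber R) A ⥤ Diag (V.fiber R) A}
    (adj' : tensorRight ((V.pbAt f A).obj M) ⊣ H') :
    IsIso (mateEquiv adj adj' (V.pbTensorRight f A M)).natTrans

end Closed

section Bicategory

variable {S : Type uS} [Category.{vS} S] [HasFiniteProducts S]
  (V : IndexedSymmetricMonoidalDerivator.{w, v, u} S)
  (P : IndexedHomotopyCoproducts V.toPseudofunctor)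

/-- The canonical map
`f_! (f^* M ⊗ N) ⟶ f_! (f^* M ⊗ f^* f_! N) ≅ f_! f^* (M ⊗ f_! N) ⟶ M ⊗ f_! N`. -/
def projectionMap {A B : S} (f : A ⟶ B) (I : Cat.{w, w}) (M : Diag (V.fiber B) I)
    (N : Diag (V.fiber A) I) :
    ((P.push f).app (op I)).toFunctor.obj ((V.pbAt f I).obj M ⊗ N) ⟶
      M ⊗ ((P.push f).app (op I)).toFunctor.obj N :=
  ((P.push f).app (op I)).toFunctor.map
      ((V.pbAt f I).obj M ◁ ((P.adj f).unit.as.app (op I)).toNatTrans.app N ≫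
        μ (V.pbAt f I) M (((P.push f).app (op I)).toFunctor.obj N)) ≫
    ((P.adj f).counit.as.app (op I)).toNatTrans.app
      (M ⊗ ((P.push f).app (op I)).toFunctor.obj N)

/-- Indexed homotopy coproducts are preserved by `⊗`. -/
def ProjectionFormula : Prop :=
  ∀ {A B : S} (f : A ⟶ B) (I : Cat.{w, w}) (M : Diag (V.fiber B) I) (N : Diag (V.fiber A) I),
    IsIso (V.projectionMap P f I M N)

/-- The external tensor product `M ⊠ N = π_R^* M ⊗ π_T^* N`, with `π_R` and `π_T` the projections of
`R ⨯ T`. -/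
noncomputable def externalTensor (R T : S) :
    Prederivator.prod (V.fiber R) (V.fiber T) ⟶ V.fiber (R ⨯ T) :=
  Prederivator.map (V.pb (prod.fst : R ⨯ T ⟶ R)) (V.pb (prod.snd : R ⨯ T ⟶ T)) ≫
    tensorMor (V.fiber (R ⨯ T))

/-- `id × Δ × id`. -/
noncomputable def middleDiag (R T U : S) : R ⨯ (T ⨯ U) ⟶ (R ⨯ T) ⨯ (T ⨯ U) :=
  prod.lift (prod.map (𝟙 R) prod.fst) prod.snd

/-- `id × π × id`. -/
noncomputable def middleProj (R T U : S) : R ⨯ (T ⨯ U) ⟶ R ⨯ U :=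
  prod.map (𝟙 R) prod.snd

/-- The derivator bicategory of `V`: its objects are those of `S`, its hom-derivators are
`V^{R × T}`, with `M ⊙ N = (id × π × id)_! (id × Δ × id)^* (M ⊠ N)` and units
`I_R = Δ_! π^* U`, for `U` the unit of the fiber over the terminal object. -/
noncomputable def di : DerivatorBicategoryData.{w, v, u, uS} where
  Obj := S
  hom R T := V.fiber (R ⨯ T)
  isDerivator_hom R T := (V.monoidal (R ⨯ T)).isDerivator
  comp R T U := V.externalTensor (R ⨯ T) (T ⨯ U) ≫ V.pb (middleDiag R T U) ≫
    P.push (middleProj R T U)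
  unit R := unitMor (V.fiber (⊤_ S)) ≫ V.pb (terminal.from R) ≫ P.push (diag R)

end Bicategory

end IndexedSymmetricMonoidalDerivator

end IndexedDerivator

open IndexedDerivator

/-!
The composition of the derivator bicategory is a composite of left adjoints: `M ⊙ N` is obtained
from `(M, N)` by pulling both variables back along projections, tensoring, pulling back along a
diagonal and pushing forward along a projection. Reindexing has right adjoints by the indexed
homotopy products, pushing forward has the right adjoint reindexing, and the tensor product is
part of a two-variable adjunction because the fibers are closed. So `⊙` is closed as soon as
two-variable adjunctions are stable under composition with adjunctions of prederivators:
afterwards (`TwoVariableAdjunction.postcomp`) and in each variable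
(`TwoVariableAdjunction.precomp`).

For the existence of the right adjoints at each shape this is composition of adjunctions. Their
pseudonaturality is the invertibility of a mate, and mates are compatible with pasting
(`isIso_mateEquiv_vComp`), so it is enough to treat the factors. For a morphism `K` of
prederivators with right adjoint `G`, the mate of the naturality square of `K` is inverse to the
naturality square of `G` (`isIso_mateEquiv_morNat`). That the naturality squares of the composite
external product are the pastings of those of the factors is `externalSquareRight_comp`,
`externalPrecompRight_square` and their left-hand versions.

The projection formula is conjugate to the hypothesis that reindexing preserves internal homs: the
square `f^* X ⊗ f^* M ≅ f^* (X ⊗ M)` has one mate given by the adjunctions of tensor and hom,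
another one given by `f_! ⊣ f^*`, and each is invertible if and only if the other one is
(`isIso_mateEquiv_symm`, `isIso_projection`). The adjoints of the internal tensor functors, as
opposed to the external ones, exist because `X ⊗ M` is the restriction of the external product of
`X` and `M` along the diagonal functor (`tensorRightIsoExternal`).
-/

namespace IndexedDerivator

/-! ### Mates and adjunctions with a parameter -/

section Mates

universe v₁ v₂ v₃ v₄ v₅ v₆ u₁ u₂ u₃ u₄ u₅ u₆

section
variable {C₁ : Type u₁} {C₂ : Type u₂} {C₃ : Type u₃} [Category.{v₁} C₁] [Category.{v₂} C₂]
  [Category.{v₃} C₃]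

/-- Right adjoints of the functors `F.obj X`, assembled into a bifunctor by taking conjugates. -/
def rightAdjointBifunctor (F : C₁ ⥤ C₂ ⥤ C₃) (R : C₁ → C₃ ⥤ C₂) (adj : ∀ X, F.obj X ⊣ R X) :
    C₁ᵒᵖ ⥤ C₃ ⥤ C₂ where
  obj X := R X.unop
  map f := conjugateEquiv (adj _) (adj _) (F.map f.unop)
  map_id X := by simp
  map_comp f g := by simp

/-- A bifunctor `F` with pointwise right adjoints is the left adjoint of an adjunction with a
parameter. -/
def parametrizedAdjunctionOfAdj (F : C₁ ⥤ C₂ ⥤ C₃) (R : C₁ → C₃ ⥤ C₂)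
    (adj : ∀ X, F.obj X ⊣ R X) : F ⊣₂ rightAdjointBifunctor F R adj where
  adj := adj
  unit_whiskerRight_map {X Y} f := by
    ext Z
    exact (unit_conjugateEquiv (adj Y) (adj X) (F.map f) Z).symm

end

variable {A : Type u₁} {B : Type u₂} {C : Type u₃} {D : Type u₄} {E : Type u₅} {F : Type u₆}
  [Category.{v₁} A] [Category.{v₂} B] [Category.{v₃} C] [Category.{v₄} D] [Category.{v₅} E]
  [Category.{v₆} F]

open TwoSquare in
/-- The mate of the pasting is the pasting of the mates. -/
theorem isIso_mateEquiv_vComp {G : A ⥤ D} {H : B ⥤ E} {K : C ⥤ F} {L₁ : A ⥤ B} {R₁ : B ⥤ A}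
    {L₂ : D ⥤ E} {R₂ : E ⥤ D} {L₃ : B ⥤ C} {R₃ : C ⥤ B} {L₄ : E ⥤ F} {R₄ : F ⥤ E}
    (adj₁ : L₁ ⊣ R₁) (adj₂ : L₂ ⊣ R₂) (adj₃ : L₃ ⊣ R₃) (adj₄ : L₄ ⊣ R₄)
    (α : TwoSquare G L₁ L₂ H) (β : TwoSquare H L₃ L₄ K)
    (hα : IsIso (mateEquiv adj₁ adj₂ α).natTrans) (hβ : IsIso (mateEquiv adj₃ adj₄ β).natTrans) :
    IsIso (mateEquiv (adj₁.comp adj₃) (adj₂.comp adj₄) (α ≫ᵥ β)).natTrans := by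
  rw [mateEquiv_hcomp]
  -- `TwoSquare` is not reducible, so instances are found only for the natural transformations.
  generalize mateEquiv adj₁ adj₂ α = a at hα
  generalize mateEquiv adj₃ adj₄ β = b at hβ
  change R₁ ⋙ G ⟶ H ⋙ R₂ at a
  change R₃ ⋙ H ⟶ K ⋙ R₄ at b
  have : IsIso a := hα
  have : IsIso b := hβ
  exact inferInstanceAs (IsIso ((Functor.associator _ _ _).hom ≫ Functor.whiskerLeft R₃ a ≫
    (Functor.associator _ _ _).inv ≫ Functor.whiskerRight b R₂ ≫ (Functor.associator _ _ _).hom))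

/-- Whether the mate of a square is invertible is unaffected by replacing the two left adjoints by
isomorphic functors, for any choice of the right adjoints. -/
theorem isIso_mateEquiv_of_iso {G : A ⥤ C} {H : B ⥤ D} {L₁ L₁' : A ⥤ B} {R₁ R₁' : B ⥤ A}
    {L₂ L₂' : C ⥤ D} {R₂ R₂' : D ⥤ C} (adj₁ : L₁ ⊣ R₁) (adj₂ : L₂ ⊣ R₂) (adj₁' : L₁' ⊣ R₁')
    (adj₂' : L₂' ⊣ R₂') (α : TwoSquare G L₁ L₂ H) (α' : TwoSquare G L₁' L₂' H)
    (e₁ : L₁' ≅ L₁) (e₂ : L₂' ≅ L₂)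
    (w : ∀ X, α'.app X ≫ H.map (e₁.hom.app X) = e₂.hom.app (G.obj X) ≫ α.app X)
    (hα : IsIso (mateEquiv adj₁ adj₂ α).natTrans) :
    IsIso (mateEquiv adj₁' adj₂' α').natTrans := by
  have h : α' = (α.whiskerRight e₂.hom).whiskerLeft e₁.inv := by
    ext X
    have := w X
    change α'.natTrans.app X = (e₂.hom.app (G.obj X) ≫ α.natTrans.app X) ≫ H.map (e₁.inv.app X)
    rw [← this, Category.assoc, ← H.map_comp]
    simp
  rw [h, conjugateEquiv_mateEquiv_vcomp adj₁' adj₁ adj₂', mateEquiv_conjugateEquiv_vcomp adj₁ adj₂]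
  generalize mateEquiv adj₁ adj₂ α = a at hα
  change R₁ ⋙ G ⟶ H ⋙ R₂ at a
  have : IsIso a := hα
  exact inferInstanceAs (IsIso (Functor.whiskerRight (conjugateEquiv adj₁' adj₁ e₁.inv) G ≫ a ≫
    Functor.whiskerLeft H (conjugateEquiv adj₂ adj₂' e₂.hom)))

end Mates

/-! ### Adjunctions of prederivators -/

section Triangles
open Bicategory
variable {X : Type*} [Bicategory X] {a b : X} {f : a ⟶ b} {g : b ⟶ a}

theorem unit_whiskerRight_comp_whiskerLeft_counit (adj : Bicategory.Adjunction f g) :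
    adj.unit ▷ f ≫ (α_ f g f).hom ≫ f ◁ adj.counit = (λ_ f).hom ≫ (ρ_ f).inv := by
  rw [← adj.left_triangle]
  bicategory

theorem whiskerLeft_unit_comp_counit_whiskerRight (adj : Bicategory.Adjunction f g) :
    g ◁ adj.unit ≫ (α_ g f g).inv ≫ adj.counit ▷ g = (ρ_ g).hom ≫ (λ_ g).inv := by
  rw [← adj.right_triangle]
  bicategory

end Triangles

section Prederivator
variable {D E : Prederivator.{w, v, u}}

/-- An adjunction in the 2-category of prederivators, evaluated at the shape `A`. -/
def adjAt {K : D ⟶ E} {G : E ⟶ D} (adj : Bicategory.Adjunction K G) (A : (Cat.{w, w})ᵒᵖ) :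
    (K.app A).toFunctor ⊣ (G.app A).toFunctor :=
  -- In both triangles the associators and unitors have identity components, up to unfolding.
  Adjunction.mkOfUnitCounit
    { unit := (adj.unit.as.app A).toNatTrans
      counit := (adj.counit.as.app A).toNatTrans
      left_triangle := by
        ext X
        have h₀ : adj.unit ▷ K ≫ (α_ K G K).hom ≫ K ◁ adj.counit = (λ_ K).hom ≫ (ρ_ K).inv :=
          unit_whiskerRight_comp_whiskerLeft_counit adj
        have h := congr(($(h₀).as.app A).toNatTrans.app X)
        change (K.app A).toFunctor.map ((adj.unit.as.app A).toNatTrans.app X) ≫ 𝟙 _ ≫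
          (adj.counit.as.app A).toNatTrans.app _ = 𝟙 _ ≫ 𝟙 _ at h
        exact h.trans (Category.comp_id _)
      right_triangle := by
        ext X
        have h₀ : G ◁ adj.unit ≫ (α_ G K G).inv ≫ adj.counit ▷ G = (ρ_ G).hom ≫ (λ_ G).inv :=
          whiskerLeft_unit_comp_counit_whiskerRight adj
        have h := congr(($(h₀).as.app A).toNatTrans.app X)
        change (adj.unit.as.app A).toNatTrans.app _ ≫ 𝟙 _ ≫
          (G.app A).toFunctor.map ((adj.counit.as.app A).toNatTrans.app X) = 𝟙 _ ≫ 𝟙 _ at h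
        exact h.trans (Category.comp_id _) }

/-- Naturality of the squares `morNat K f` in the 2-cell variable `f`. -/
theorem morNat_resMap (K : D ⟶ E) {A B : Cat.{w, w}} {f g : A ⟶ B} (α : f ⟶ g) (X : Diag D B) :
    (K.app (op A)).toFunctor.map ((resMap D α).app X) ≫ (morNat K g).natTrans.app X =
      (morNat K f).natTrans.app X ≫ (resMap E α).app ((K.app (op B)).toFunctor.obj X) :=
  congr($(K.naturality_naturality (op2 α)).toNatTrans.app X)

/-- The square `morNat K (f ≫ g)` is the pasting of those of `f` and `g`. -/
theorem morNat_resComp (K : D ⟶ E) {A B C : Cat.{w, w}} (f : A ⟶ B) (g : B ⟶ C) (X : Diag D C) :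
    (K.app (op A)).toFunctor.map ((resComp D f g).hom.app X) ≫
        (morNat K f).natTrans.app ((res D g).obj X) ≫ (res E f).map ((morNat K g).natTrans.app X) =
      (morNat K (f ≫ g)).natTrans.app X ≫
        (resComp E f g).hom.app ((K.app (op C)).toFunctor.obj X) := by
  have h := congr($(K.naturality_comp g.op f.op).toNatTrans.app X)
  change (morNat K (f ≫ g)).natTrans.app X ≫
      (resComp E f g).hom.app ((K.app (op C)).toFunctor.obj X) =
    (K.app (op A)).toFunctor.map ((resComp D f g).hom.app X) ≫ 𝟙 _ ≫
      (morNat K f).natTrans.app ((res D g).obj X) ≫ 𝟙 _ ≫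
      (res E f).map ((morNat K g).natTrans.app X) ≫ 𝟙 _ at h
  rw [h]
  simp only [Category.id_comp, Category.comp_id]

theorem morNat_comp_app {E' : Prederivator.{w, v, u}} (K : D ⟶ E) (G : E ⟶ E') {A B : Cat.{w, w}}
    (f : A ⟶ B) (X : Diag D B) :
    (morNat (K ≫ G) f).natTrans.app X =
      (G.app (op A)).toFunctor.map ((morNat K f).natTrans.app X) ≫
        (morNat G f).natTrans.app ((K.app (op B)).toFunctor.obj X) := by
  change 𝟙 _ ≫ (G.app (op A)).toFunctor.map ((morNat K f).natTrans.app X) ≫ 𝟙 _ ≫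
    (morNat G f).natTrans.app ((K.app (op B)).toFunctor.obj X) ≫ 𝟙 _ = _
  simp only [Category.id_comp, Category.comp_id]

/-- The unit of an adjunction of prederivators is a modification. -/
theorem unit_morNat {K : D ⟶ E} {G : E ⟶ D} (adj : Bicategory.Adjunction K G) {A B : Cat.{w, w}}
    (f : A ⟶ B) (X : Diag D B) :
    (adjAt adj (op A)).unit.app ((res D f).obj X) ≫
        (G.app (op A)).toFunctor.map ((morNat K f).natTrans.app X) ≫
        (morNat G f).natTrans.app ((K.app (op B)).toFunctor.obj X) =
      (res D f).map ((adjAt adj (op B)).unit.app X) := by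
  have h := congr($(adj.unit.as.naturality f.op).toNatTrans.app X)
  change (adjAt adj (op A)).unit.app ((res D f).obj X) ≫ (morNat (K ≫ G) f).natTrans.app X =
    (𝟙 _ ≫ 𝟙 _) ≫ (res D f).map ((adjAt adj (op B)).unit.app X) at h
  rw [morNat_comp_app] at h
  exact h.trans (by simp)

instance (K : D ⟶ E) {A B : Cat.{w, w}} (f : A ⟶ B) : IsIso (morNat K f).natTrans :=
  inferInstanceAs (IsIso (Cat.Hom.toNatIso (K.naturality f.op)).hom)

/-- The mates of the naturality squares of a left adjoint morphism of prederivators are inverse to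
the naturality squares of its right adjoint. -/
theorem isIso_mateEquiv_morNat {K : D ⟶ E} {G : E ⟶ D} (adj : Bicategory.Adjunction K G)
    {A B : Cat.{w, w}} (f : A ⟶ B) :
    IsIso (mateEquiv (adjAt adj (op B)) (adjAt adj (op A)) (morNat K f)).natTrans := by
  -- It suffices that the mate is a section of the invertible naturality square of `G`.
  suffices (mateEquiv (adjAt adj (op B)) (adjAt adj (op A)) (morNat K f)).natTrans ≫
      (morNat G f).natTrans = 𝟙 _ by
    rw [← IsIso.eq_comp_inv] at this
    rw [this]
    infer_instance
  ext Z
  have h : (mateEquiv (adjAt adj (op B)) (adjAt adj (op A)) (morNat K f)).natTrans.app Z =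
      (adjAt adj (op A)).unit.app _ ≫ (G.app (op A)).toFunctor.map
        ((morNat K f).natTrans.app _ ≫ (res E f).map ((adjAt adj (op B)).counit.app Z)) := by
    simp
  have h' := (morNat G f).natTrans.naturality ((adjAt adj (op B)).counit.app Z)
  have h'' := unit_morNat adj f ((G.app (op B)).toFunctor.obj Z)
  rw [NatTrans.comp_app, h, Functor.map_comp, Category.assoc, Category.assoc]
  erw [h', reassoc_of% h'']
  change (res D f).map _ ≫ (res D f).map ((G.app (op B)).toFunctor.map _) = _
  rw [← Functor.map_comp, Adjunction.right_triangle_components]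
  simp

/-- The compatibility of `morNat` with the squares of 2-cells of small categories. -/
theorem morNat_resSquare (K : D ⟶ E) {A B C I : Cat.{w, w}} {p : I ⟶ A} {f : A ⟶ B}
    {q : I ⟶ C} {g : C ⟶ B} (α : p ≫ f ⟶ q ≫ g) (X : Diag D B) :
    (K.app (op I)).toFunctor.map ((resSquare D α).natTrans.app X) ≫
        (morNat K q).natTrans.app ((res D g).obj X) ≫
        (res E q).map ((morNat K g).natTrans.app X) =
      (morNat K p).natTrans.app ((res D f).obj X) ≫
        (res E p).map ((morNat K f).natTrans.app X) ≫
        (resSquare E α).natTrans.app ((K.app (op B)).toFunctor.obj X) := by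
  have h (F : Prederivator.{w, v, u}) (Y : Diag F B) : (resSquare F α).natTrans.app Y =
    (resComp F p f).inv.app Y ≫ (resMap F α).app Y ≫ (resComp F q g).hom.app Y := rfl
  have h' := morNat_resComp K p f X
  rw [h, h, Functor.map_comp, Functor.map_comp, Category.assoc, Category.assoc, morNat_resComp,
    reassoc_of% (morNat_resMap K α X),
    ← cancel_epi ((K.app (op I)).toFunctor.map ((resComp D p f).hom.app X)),
    reassoc_of% h', ← Functor.map_comp_assoc]
  simp

theorem morNat_resTriangle (K : D ⟶ E) {A C I : Cat.{w, w}} {p : I ⟶ A}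
    {q : I ⟶ C} {g : C ⟶ A} (α : p ⟶ q ≫ g) (X : Diag D A) :
    (K.app (op I)).toFunctor.map ((resTriangle D α).app X) ≫
        (morNat K q).natTrans.app ((res D g).obj X) ≫
        (res E q).map ((morNat K g).natTrans.app X) =
      (morNat K p).natTrans.app X ≫
        (resTriangle E α).app ((K.app (op A)).toFunctor.obj X) := by
  have h (F : Prederivator.{w, v, u}) (Y : Diag F A) : (resTriangle F α).app Y =
    (resMap F α).app Y ≫ (resComp F q g).hom.app Y := rfl
  simp only [h, Functor.map_comp, Category.assoc, morNat_resComp, reassoc_of% (morNat_resMap K α X)]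

end Prederivator

/-! ### Composing two-variable adjunctions with adjunctions of prederivators -/

section TwoVariable
variable {D₁ D₂ D₃ D₁' D₂' D₄ : Prederivator.{w, v, u}}

/-- A two-variable adjunction of derivators is already given by right adjoints of the external
products in each variable separately. -/
def TwoVariableAdjunction.ofAdj (F : Prederivator.prod D₁ D₂ ⟶ D₃)
    (R : ∀ {A : Cat.{w, w}} (_ : Diag D₁ A) (B : Cat.{w, w}), Diag D₃ (prodCat A B) ⥤ Diag D₂ B)
    (L : ∀ (A : Cat.{w, w}) {B : Cat.{w, w}} (_ : Diag D₂ B), Diag D₃ (prodCat A B) ⥤ Diag D₁ A)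
    (adjR : ∀ {A : Cat.{w, w}} (X : Diag D₁ A) (B : Cat.{w, w}), (external F A B).obj X ⊣ R X B)
    (adjL : ∀ (A : Cat.{w, w}) {B : Cat.{w, w}} (Y : Diag D₂ B),
      (external F A B).flip.obj Y ⊣ L A Y)
    (hR : ∀ {A : Cat.{w, w}} (X : Diag D₁ A) {B B' : Cat.{w, w}} (g : B ⟶ B'),
      IsIso (mateEquiv (adjR X B') (adjR X B) (externalSquareRight F X g)).natTrans)
    (hL : ∀ {A A' : Cat.{w, w}} (f : A ⟶ A') {B : Cat.{w, w}} (Y : Diag D₂ B),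
      IsIso (mateEquiv (adjL A' Y) (adjL A Y) (externalSquareLeft F f Y)).natTrans) :
    TwoVariableAdjunction F where
  homRight _ B := rightAdjointBifunctor _ (fun X => R X B) (fun X => adjR X B)
  homLeft A _ := rightAdjointBifunctor _ (fun Y => L A Y) (fun Y => adjL A Y)
  adjRight _ _ := parametrizedAdjunctionOfAdj _ _ _
  adjLeft _ _ := parametrizedAdjunctionOfAdj _ _ _
  isIso_right X _ _ g := hR X g
  isIso_left f _ Y := hL f Y

section Pair
variable (F : Prederivator.prod D₁ D₂ ⟶ D₃)

/-- The value `X ⊛ Y` of a two-variable morphism, in curried form. -/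
abbrev pairObj {C : Cat.{w, w}} (X : Diag D₁ C) (Y : Diag D₂ C) : Diag D₃ C :=
  (F.app (op C)).toFunctor.obj (X, Y)

/-- The map `φ ⊛ ψ`. -/
def pairMap {C : Cat.{w, w}} {X X' : Diag D₁ C} {Y Y' : Diag D₂ C} (φ : X ⟶ X') (ψ : Y ⟶ Y') :
    pairObj F X Y ⟶ pairObj F X' Y' :=
  (F.app (op C)).toFunctor.map (X := (X, Y)) (Y := (X', Y')) (φ, ψ)

/-- The isomorphism `f^* X ⊛ f^* Y ⟶ f^* (X ⊛ Y)`. -/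
def pairNat {A B : Cat.{w, w}} (f : A ⟶ B) (X : Diag D₁ B) (Y : Diag D₂ B) :
    pairObj F ((res D₁ f).obj X) ((res D₂ f).obj Y) ⟶ (res D₃ f).obj (pairObj F X Y) :=
  (morNat F f).natTrans.app (X, Y)

theorem pairMap_comp {C : Cat.{w, w}} {X X' X'' : Diag D₁ C} {Y Y' Y'' : Diag D₂ C} (φ : X ⟶ X')
    (φ' : X' ⟶ X'') (ψ : Y ⟶ Y') (ψ' : Y' ⟶ Y'') :
    pairMap F (φ ≫ φ') (ψ ≫ ψ') = pairMap F φ ψ ≫ pairMap F φ' ψ' :=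
  (F.app (op C)).toFunctor.map_comp (X := (X, Y)) (Y := (X', Y')) (Z := (X'', Y'')) (φ, ψ) (φ', ψ')

theorem pairNat_natural {A B : Cat.{w, w}} (f : A ⟶ B) {X X' : Diag D₁ B} {Y Y' : Diag D₂ B}
    (φ : X ⟶ X') (ψ : Y ⟶ Y') :
    pairMap F ((res D₁ f).map φ) ((res D₂ f).map ψ) ≫ pairNat F f X' Y' =
      pairNat F f X Y ≫ (res D₃ f).map (pairMap F φ ψ) :=
  (morNat F f).natTrans.naturality (X := (X, Y)) (Y := (X', Y')) (φ, ψ)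

theorem pairNat_comp (K : D₃ ⟶ D₄) {A B : Cat.{w, w}} (f : A ⟶ B) (X : Diag D₁ B)
    (Y : Diag D₂ B) :
    pairNat (F ≫ K) f X Y = (K.app (op A)).toFunctor.map (pairNat F f X Y) ≫
      (morNat K f).natTrans.app (pairObj F X Y) :=
  morNat_comp_app F K f (X, Y)

theorem morNat_map_app (K₁ : D₁' ⟶ D₁) (K₂ : D₂' ⟶ D₂) {A B : Cat.{w, w}} (f : A ⟶ B)
    (X : Diag (Prederivator.prod D₁' D₂') B) :
    (morNat (Prederivator.map K₁ K₂) f).natTrans.app X =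
      ((morNat K₁ f).natTrans.app X.1, (morNat K₂ f).natTrans.app X.2) := by
  have h {E E' : Prederivator.{w, v, u}} (K : E ⟶ E') (Y : Diag E B) :
      (K.app (op A)).toFunctor.map (𝟙 ((res E f).obj Y)) ≫ (morNat K f).natTrans.app Y =
        (morNat K f).natTrans.app Y :=
    (congrArg (· ≫ _) ((K.app (op A)).toFunctor.map_id _)).trans (Category.id_comp _)
  exact Prod.ext ((morNat_comp_app (Prederivator.fst _ _) K₁ f X).trans (h K₁ X.1))
    ((morNat_comp_app (Prederivator.snd _ _) K₂ f X).trans (h K₂ X.2))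

theorem pairNat_map_comp (K₁ : D₁' ⟶ D₁) (K₂ : D₂' ⟶ D₂) {A B : Cat.{w, w}} (f : A ⟶ B)
    (X : Diag D₁' B) (Y : Diag D₂' B) :
    pairNat (Prederivator.map K₁ K₂ ≫ F) f X Y =
      pairMap F ((morNat K₁ f).natTrans.app X) ((morNat K₂ f).natTrans.app Y) ≫
        pairNat F f ((K₁.app (op B)).toFunctor.obj X) ((K₂.app (op B)).toFunctor.obj Y) :=
  (morNat_comp_app (Prederivator.map K₁ K₂) F f (X, Y)).trans
    (congrArg (fun t => (F.app (op A)).toFunctor.map t ≫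
      (morNat F f).natTrans.app (((Prederivator.map K₁ K₂).app (op B)).toFunctor.obj (X, Y)))
      (morNat_map_app K₁ K₂ f (X, Y)))

end Pair

/-- The pasting computation behind `externalPrecompRight_square` and `externalPrecompLeft_square`:
an identity between composites in each variable of `⊛` gives an identity between composites of
values of `⊛`. The identity morphisms are the associators in a pasting of squares. -/
theorem pairMap_pairNat_paste (F : Prederivator.prod D₁ D₂ ⟶ D₃) {A B : Cat.{w, w}} (f : A ⟶ B)
    {M₁ N₁ P₁ Q₁ : Diag D₁ A} {R₁ T₁ : Diag D₁ B} {M₂ N₂ P₂ Q₂ : Diag D₂ A} {R₂ T₂ : Diag D₂ B}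
    {a₁ : M₁ ⟶ N₁} {b₁ : N₁ ⟶ (res D₁ f).obj R₁} {c₁ : R₁ ⟶ T₁} {d₁ : M₁ ⟶ P₁} {e₁ : P₁ ⟶ Q₁}
    {k₁ : Q₁ ⟶ (res D₁ f).obj T₁}
    {a₂ : M₂ ⟶ N₂} {b₂ : N₂ ⟶ (res D₂ f).obj R₂} {c₂ : R₂ ⟶ T₂} {d₂ : M₂ ⟶ P₂} {e₂ : P₂ ⟶ Q₂}
    {k₂ : Q₂ ⟶ (res D₂ f).obj T₂}
    (h₁ : a₁ ≫ b₁ ≫ (res D₁ f).map c₁ = d₁ ≫ e₁ ≫ k₁)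
    (h₂ : a₂ ≫ b₂ ≫ (res D₂ f).map c₂ = d₂ ≫ e₂ ≫ k₂) :
    (pairMap F a₁ a₂ ≫ pairMap F b₁ b₂ ≫ pairNat F f R₁ R₂) ≫ (res D₃ f).map (pairMap F c₁ c₂) =
      pairMap F d₁ d₂ ≫ 𝟙 _ ≫ pairMap F e₁ e₂ ≫ 𝟙 _ ≫
        (pairMap F k₁ k₂ ≫ pairNat F f T₁ T₂) ≫ 𝟙 _ := by
  have h : pairMap F (a₁ ≫ b₁ ≫ (res D₁ f).map c₁) (a₂ ≫ b₂ ≫ (res D₂ f).map c₂) =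
      pairMap F (d₁ ≫ e₁ ≫ k₁) (d₂ ≫ e₂ ≫ k₂) := by rw [h₁, h₂]
  simp only [pairMap_comp] at h
  have h' := congrArg (· ≫ pairNat F f T₁ T₂) h
  simpa only [Category.assoc, Category.id_comp, Category.comp_id, pairNat_natural] using h'

/-- The identity morphisms on the right-hand side are the associators in a pasting of squares. -/
theorem map_comp_morNat_paste (K : D₃ ⟶ D₄) {A B : Cat.{w, w}} (f : A ⟶ B) {X Y : Diag D₃ A}
    {Z : Diag D₃ B}
    (a : X ⟶ Y) (b : Y ⟶ (res D₃ f).obj Z) :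
    (K.app (op A)).toFunctor.map a ≫ (K.app (op A)).toFunctor.map b ≫
        (morNat K f).natTrans.app Z =
      𝟙 _ ≫ (K.app (op A)).toFunctor.map (a ≫ b) ≫ 𝟙 _ ≫ (morNat K f).natTrans.app Z ≫ 𝟙 _ := by
  simp only [Functor.map_comp, Category.assoc, Category.id_comp, Category.comp_id]

open TwoSquare in
/-- The naturality square of the external product of `F ≫ K` is the pasting of those of `F` and
`K`. -/
theorem externalSquareRight_comp (F : Prederivator.prod D₁ D₂ ⟶ D₃) (K : D₃ ⟶ D₄)
    {A B B' : Cat.{w, w}} (X : Diag D₁ A) (g : B ⟶ B') :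
    externalSquareRight (F ≫ K) X g =
      externalSquareRight F X g ≫ᵥ morNat K (prodMap (𝟙 A) g) := by
  ext Y
  refine (congrArg (_ ≫ ·) (pairNat_comp F K (prodMap (𝟙 A) g) _ _)).trans ?_
  exact map_comp_morNat_paste K (prodMap (𝟙 A) g) (pairMap F _ _) (pairNat F _ _ _)

open TwoSquare in
theorem externalSquareLeft_comp (F : Prederivator.prod D₁ D₂ ⟶ D₃) (K : D₃ ⟶ D₄)
    {A A' B : Cat.{w, w}} (f : A ⟶ A') (Y : Diag D₂ B) :
    externalSquareLeft (F ≫ K) f Y =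
      externalSquareLeft F f Y ≫ᵥ morNat K (prodMap f (𝟙 B)) := by
  ext X
  refine (congrArg (_ ≫ ·) (pairNat_comp F K (prodMap f (𝟙 B)) _ _)).trans ?_
  exact map_comp_morNat_paste K (prodMap f (𝟙 B)) (pairMap F _ _) (pairNat F _ _ _)

/-- The left adjoint of a two-variable adjunction may be followed by a left adjoint morphism. -/
def TwoVariableAdjunction.postcomp {F : Prederivator.prod D₁ D₂ ⟶ D₃}
    (T : TwoVariableAdjunction F) {K : D₃ ⟶ D₄} {G : D₄ ⟶ D₃} (adj : Bicategory.Adjunction K G) :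
    TwoVariableAdjunction (F ≫ K) :=
  .ofAdj (F ≫ K)
    (fun {A} X B => (G.app (op (prodCat A B))).toFunctor ⋙ (T.homRight A B).obj (op X))
    (fun A {B} Y => (G.app (op (prodCat A B))).toFunctor ⋙ (T.homLeft A B).obj (op Y))
    (fun {A} X B => ((T.adjRight A B).adj X).comp (adjAt adj (op (prodCat A B))))
    (fun A {B} Y => ((T.adjLeft A B).adj Y).comp (adjAt adj (op (prodCat A B))))
    (fun {A} X {B B'} g => by
      rw [externalSquareRight_comp]
      exact isIso_mateEquiv_vComp ((T.adjRight A B').adj X) ((T.adjRight A B).adj X) _ _ _ _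
        (T.isIso_right X g) (isIso_mateEquiv_morNat adj (prodMap (𝟙 A) g)))
    (fun {A A'} f {B} Y => by
      rw [externalSquareLeft_comp]
      exact isIso_mateEquiv_vComp ((T.adjLeft A' B).adj Y) ((T.adjLeft A B).adj Y) _ _ _ _
        (T.isIso_left f Y) (isIso_mateEquiv_morNat adj (prodMap f (𝟙 B))))

/-- The isomorphism `K₁ (π_A^* X) ⊛ K₂ (π_B^* Y) ≅ π_A^* (K₁ X) ⊛ π_B^* (K₂ Y)`. -/
noncomputable def externalUncurriedPrecomp (K₁ : D₁' ⟶ D₁) (K₂ : D₂' ⟶ D₂)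
    (F : Prederivator.prod D₁ D₂ ⟶ D₃) (A B : Cat.{w, w}) :
    externalUncurried (Prederivator.map K₁ K₂ ≫ F) A B ≅
      (K₁.app (op A)).toFunctor.prod (K₂.app (op B)).toFunctor ⋙ externalUncurried F A B :=
  Functor.isoWhiskerRight
    (NatIso.prod (asIso (morNat K₁ (prodFst A B)).natTrans)
      (asIso (morNat K₂ (prodSnd A B)).natTrans))
    (F.app (op (prodCat A B))).toFunctor

/-- `externalUncurriedPrecomp` with `X` fixed. -/
noncomputable def externalPrecompRight (K₁ : D₁' ⟶ D₁) (K₂ : D₂' ⟶ D₂)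
    (F : Prederivator.prod D₁ D₂ ⟶ D₃) {A : Cat.{w, w}} (X : Diag D₁' A) (B : Cat.{w, w}) :
    (external (Prederivator.map K₁ K₂ ≫ F) A B).obj X ≅
      (K₂.app (op B)).toFunctor ⋙ (external F A B).obj ((K₁.app (op A)).toFunctor.obj X) :=
  NatIso.ofComponents (fun Y => (externalUncurriedPrecomp K₁ K₂ F A B).app (X, Y))
    (fun {Y Y'} φ => by
      have h := (externalUncurriedPrecomp K₁ K₂ F A B).hom.naturality
        (X := (X, Y)) (Y := (X, Y')) (𝟙 X, φ)
      refine h.trans (congrArg (_ ≫ ·) (congrArg (externalUncurried F A B).map ?_))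
      exact Prod.ext ((K₁.app (op A)).toFunctor.map_id X) rfl)

/-- `externalUncurriedPrecomp` with `Y` fixed. -/
noncomputable def externalPrecompLeft (K₁ : D₁' ⟶ D₁) (K₂ : D₂' ⟶ D₂)
    (F : Prederivator.prod D₁ D₂ ⟶ D₃) (A : Cat.{w, w}) {B : Cat.{w, w}} (Y : Diag D₂' B) :
    (external (Prederivator.map K₁ K₂ ≫ F) A B).flip.obj Y ≅
      (K₁.app (op A)).toFunctor ⋙ (external F A B).flip.obj ((K₂.app (op B)).toFunctor.obj Y) :=
  NatIso.ofComponents (fun X => (externalUncurriedPrecomp K₁ K₂ F A B).app (X, Y))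
    (fun {X X'} φ => by
      have h := (externalUncurriedPrecomp K₁ K₂ F A B).hom.naturality
        (X := (X, Y)) (Y := (X', Y)) (φ, 𝟙 Y)
      refine h.trans (congrArg (_ ≫ ·) (congrArg (externalUncurried F A B).map ?_))
      exact Prod.ext rfl ((K₂.app (op B)).toFunctor.map_id Y))

open TwoSquare in
/-- Up to `externalPrecompRight`, the naturality square of the external product of
`(K₁ × K₂) ≫ F` is the pasting of those of `K₂` and `F`. -/
theorem externalPrecompRight_square (K₁ : D₁' ⟶ D₁) (K₂ : D₂' ⟶ D₂)
    (F : Prederivator.prod D₁ D₂ ⟶ D₃) {A B B' : Cat.{w, w}} (X : Diag D₁' A) (g : B ⟶ B')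
    (Y : Diag D₂' B') :
    (externalSquareRight (Prederivator.map K₁ K₂ ≫ F) X g).natTrans.app Y ≫
        (res D₃ (prodMap (𝟙 A) g)).map ((externalPrecompRight K₁ K₂ F X B').hom.app Y) =
      (externalPrecompRight K₁ K₂ F X B).hom.app ((res D₂' g).obj Y) ≫
        (morNat K₂ g ≫ᵥ
          externalSquareRight F ((K₁.app (op A)).toFunctor.obj X) g).natTrans.app Y := by
  have h₁ := morNat_resTriangle K₁ (p := prodFst A B) (q := prodMap (𝟙 A) g)
    (g := prodFst A B') (𝟙 _) X
  have h₂ := morNat_resSquare K₂ (p := prodSnd A B) (f := g) (q := prodMap (𝟙 A) g)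
    (g := prodSnd A B') (𝟙 _) Y
  have hN := pairNat_map_comp F K₁ K₂ (prodMap (𝟙 A) g) ((res D₁' (prodFst A B')).obj X)
    ((res D₂' (prodSnd A B')).obj Y)
  refine (congrArg (fun t => (_ ≫ t) ≫ _) hN).trans ?_
  refine pairMap_pairNat_paste F (prodMap (𝟙 A) g) ?_ h₂
  exact h₁.trans (congrArg (_ ≫ ·) ((Category.id_comp _).symm.trans
    (congrArg (· ≫ _) (CategoryTheory.Functor.map_id _ _).symm)))

open TwoSquare in
/-- Up to `externalPrecompLeft`, the naturality square of the external product of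
`(K₁ × K₂) ≫ F` is the pasting of those of `K₁` and `F`. -/
theorem externalPrecompLeft_square (K₁ : D₁' ⟶ D₁) (K₂ : D₂' ⟶ D₂)
    (F : Prederivator.prod D₁ D₂ ⟶ D₃) {A A' B : Cat.{w, w}} (f : A ⟶ A') (Y : Diag D₂' B)
    (X : Diag D₁' A') :
    (externalSquareLeft (Prederivator.map K₁ K₂ ≫ F) f Y).natTrans.app X ≫
        (res D₃ (prodMap f (𝟙 B))).map ((externalPrecompLeft K₁ K₂ F A' Y).hom.app X) =
      (externalPrecompLeft K₁ K₂ F A Y).hom.app ((res D₁' f).obj X) ≫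
        (morNat K₁ f ≫ᵥ
          externalSquareLeft F f ((K₂.app (op B)).toFunctor.obj Y)).natTrans.app X := by
  have h₁ := morNat_resSquare K₁ (p := prodFst A B) (f := f) (q := prodMap f (𝟙 B))
    (g := prodFst A' B) (𝟙 _) X
  have h₂ := morNat_resTriangle K₂ (p := prodSnd A B) (q := prodMap f (𝟙 B))
    (g := prodSnd A' B) (𝟙 _) Y
  have hN := pairNat_map_comp F K₁ K₂ (prodMap f (𝟙 B)) ((res D₁' (prodFst A' B)).obj X)
    ((res D₂' (prodSnd A' B)).obj Y)
  refine (congrArg (fun t => (_ ≫ t) ≫ _) hN).trans ?_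
  refine pairMap_pairNat_paste F (prodMap f (𝟙 B)) h₁ ?_
  exact h₂.trans (congrArg (_ ≫ ·) ((Category.id_comp _).symm.trans
    (congrArg (· ≫ _) (CategoryTheory.Functor.map_id _ _).symm)))

/-- The left adjoint of a two-variable adjunction may be preceded by a left adjoint morphism in each
variable. -/
noncomputable def TwoVariableAdjunction.precomp {F : Prederivator.prod D₁ D₂ ⟶ D₃}
    (T : TwoVariableAdjunction F) {K₁ : D₁' ⟶ D₁} {G₁ : D₁ ⟶ D₁'}
    (adj₁ : Bicategory.Adjunction K₁ G₁)
    {K₂ : D₂' ⟶ D₂} {G₂ : D₂ ⟶ D₂'} (adj₂ : Bicategory.Adjunction K₂ G₂) :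
    TwoVariableAdjunction (Prederivator.map K₁ K₂ ≫ F) :=
  .ofAdj (Prederivator.map K₁ K₂ ≫ F)
    (fun {A} X B =>
      (T.homRight A B).obj (op ((K₁.app (op A)).toFunctor.obj X)) ⋙ (G₂.app (op B)).toFunctor)
    (fun A {B} Y =>
      (T.homLeft A B).obj (op ((K₂.app (op B)).toFunctor.obj Y)) ⋙ (G₁.app (op A)).toFunctor)
    (fun {A} X B => ((adjAt adj₂ (op B)).comp
      ((T.adjRight A B).adj ((K₁.app (op A)).toFunctor.obj X))).ofNatIsoLeft
        (externalPrecompRight K₁ K₂ F X B).symm)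
    (fun A {B} Y => ((adjAt adj₁ (op A)).comp
      ((T.adjLeft A B).adj ((K₂.app (op B)).toFunctor.obj Y))).ofNatIsoLeft
        (externalPrecompLeft K₁ K₂ F A Y).symm)
    (fun {A} X {B B'} g => by
      exact isIso_mateEquiv_of_iso
        ((adjAt adj₂ (op B')).comp ((T.adjRight A B').adj ((K₁.app (op A)).toFunctor.obj X)))
        ((adjAt adj₂ (op B)).comp ((T.adjRight A B).adj ((K₁.app (op A)).toFunctor.obj X)))
        _ _ _ _ (externalPrecompRight K₁ K₂ F X B')
        (externalPrecompRight K₁ K₂ F X B) (externalPrecompRight_square K₁ K₂ F X g)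
        (isIso_mateEquiv_vComp _ _ _ _ _ _ (isIso_mateEquiv_morNat adj₂ g) (T.isIso_right _ g)))
    (fun {A A'} f {B} Y => by
      exact isIso_mateEquiv_of_iso
        ((adjAt adj₁ (op A')).comp ((T.adjLeft A' B).adj ((K₂.app (op B)).toFunctor.obj Y)))
        ((adjAt adj₁ (op A)).comp ((T.adjLeft A B).adj ((K₂.app (op B)).toFunctor.obj Y)))
        _ _ _ _ (externalPrecompLeft K₁ K₂ F A' Y)
        (externalPrecompLeft K₁ K₂ F A Y) (externalPrecompLeft_square K₁ K₂ F f Y)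
        (isIso_mateEquiv_vComp _ _ _ _ _ _ (isIso_mateEquiv_morNat adj₁ f) (T.isIso_left f _)))

end TwoVariable

/-! ### The projection formula for monoidal categories -/

section Monoidal
open MonoidalCategory Functor.LaxMonoidal Functor.Monoidal

universe v₁ v₂ v₃ v₄ u₁ u₂ u₃ u₄

/-- If all four sides of a square have adjoints, then inverting one of the two mates inverts the
other, since the two mates are conjugate. -/
theorem isIso_mateEquiv_symm {A : Type u₁} {B : Type u₂} {C : Type u₃} {D : Type u₄}
    [Category.{v₁} A] [Category.{v₂} B] [Category.{v₃} C] [Category.{v₄} D]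
    {F₁ : A ⥤ C} {U₁ : C ⥤ A} {F₂ : B ⥤ D} {U₂ : D ⥤ B} {L₁ : A ⥤ B} {R₁ : B ⥤ A} {L₂ : C ⥤ D}
    {R₂ : D ⥤ C} (adj₁ : L₁ ⊣ R₁) (adj₂ : L₂ ⊣ R₂) (adj₃ : F₁ ⊣ U₁) (adj₄ : F₂ ⊣ U₂)
    (α : TwoSquare R₁ F₂ F₁ R₂) (h : IsIso (mateEquiv adj₄ adj₃ α).natTrans) :
    IsIso ((mateEquiv adj₁ adj₂).symm α).natTrans := by
  have e := iterated_mateEquiv_conjugateEquiv adj₁ adj₂ adj₃ adj₄ ((mateEquiv adj₁ adj₂).symm α)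
  rw [Equiv.apply_symm_apply] at e
  rw [e] at h
  exact conjugateEquiv_of_iso (adj₁.comp adj₄) (adj₃.comp adj₂) _

variable {C : Type u₁} {D : Type u₂} [Category.{v₁} C] [Category.{v₂} D] [MonoidalCategory C]
  [MonoidalCategory D]

/-- The projection formula for a braided functor `U` with left adjoint `L` follows, by taking
conjugates, from the compatibility of `U` with internal homs. -/
theorem isIso_projection [BraidedCategory C] [BraidedCategory D] {U : D ⥤ C} [U.Braided]
    {L : C ⥤ D} (adj : L ⊣ U) {M : D} {H : D ⥤ D} {H' : C ⥤ C} (a : tensorRight M ⊣ H)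
    (a' : tensorRight (U.obj M) ⊣ H') (α : TwoSquare U (tensorRight M) (tensorRight (U.obj M)) U)
    (hα : ∀ X, α.natTrans.app X = μ U X M) (h : IsIso (mateEquiv a a' α).natTrans) (N : C) :
    IsIso (L.map (U.obj M ◁ adj.unit.app N ≫ μ U M (L.obj N)) ≫ adj.counit.app (M ⊗ L.obj N)) := by
  have h' := isIso_mateEquiv_symm adj adj a' a α h
  have hN := NatIso.isIso_app_of_isIso ((mateEquiv adj adj).symm α).natTrans N
  have e : ((mateEquiv adj adj).symm α).natTrans.app N =
      L.map (adj.unit.app N ▷ U.obj M ≫ μ U (L.obj N) M) ≫ adj.counit.app (L.obj N ⊗ M) := by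
    rw [← hα]
    simp
  have e' : L.map (U.obj M ◁ adj.unit.app N ≫ μ U M (L.obj N)) ≫ adj.counit.app (M ⊗ L.obj N) ≫
      (β_ M (L.obj N)).hom = L.map (β_ (U.obj M) N).hom ≫
      ((mateEquiv adj adj).symm α).natTrans.app N := by
    have hc := adj.counit.naturality (β_ M (L.obj N)).hom
    dsimp at hc
    rw [e, ← hc, ← L.map_comp_assoc, ← L.map_comp_assoc, Category.assoc,
      Functor.Braided.braided]
    simp
  -- The hypothesis concerns tensoring on the right, so the two maps differ by the braiding.
  rw [← isIso_comp_right_iff _ (β_ M (L.obj N)).hom, Category.assoc, e']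
  exact IsIso.comp_isIso

/-- If `U` is a monoidal functor that retracts two functors `P` and `Q` to the identity, then
`X ⊗ M ≅ U (P X ⊗ Q M)`, naturally in `X`. -/
def tensorRightIso {P Q : C ⥤ D} {U : D ⥤ C} [U.Monoidal] (e : 𝟭 C ≅ P ⋙ U) (e' : 𝟭 C ≅ Q ⋙ U)
    (M : C) : tensorRight M ≅ (P ⋙ tensorRight (Q.obj M)) ⋙ U :=
  NatIso.ofComponents (fun X => (e.app X ⊗ᵢ e'.app M) ≪≫ μIso U (P.obj X) (Q.obj M))
    (fun {X Y} φ => by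
      have h := e.hom.naturality φ
      change φ ▷ M ≫ (e.hom.app Y ⊗ₘ e'.hom.app M) ≫ μ U _ _ =
        ((e.hom.app X ⊗ₘ e'.hom.app M) ≫ μ U _ _) ≫ U.map (P.map φ ▷ Q.obj M)
      dsimp at h
      rw [Category.assoc, ← μ_natural_left, ← MonoidalCategory.tensorHom_id,
        ← MonoidalCategory.tensorHom_id, MonoidalCategory.tensorHom_comp_tensorHom_assoc,
        MonoidalCategory.tensorHom_comp_tensorHom_assoc, h, Category.id_comp]
      simp)

end Monoidal

/-! ### Adjoints of the internal tensor functors -/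

section InternalHom
open MonoidalCategory

variable (D : Prederivator.{w, v, u})

/-- The diagonal functor of a small category. -/
def diagCat (A : Cat.{w, w}) : A ⟶ prodCat A A := .ofFunctor (Functor.diag A)

/-- For a retraction `r` with section `s`, the composite `s^* r^*` is the identity. -/
def resRetract {A B : Cat.{w, w}} (s : A ⟶ B) (r : B ⟶ A) (h : s ≫ r = 𝟙 A) :
    𝟭 (Diag D A) ≅ res D r ⋙ res D s :=
  (resId D A).symm ≪≫ eqToIso (congrArg (res D) h.symm) ≪≫ resComp D s r

variable [SymmetricMonoidalStructure D]

/-- The external tensor product with `M` in the second variable. -/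
def externalTensorMorIso {A B : Cat.{w, w}} (M : Diag D B) :
    (external (tensorMor D) A B).flip.obj M ≅
      res D (prodFst A B) ⋙ tensorRight ((res D (prodSnd A B)).obj M) :=
  NatIso.ofComponents (fun X => Iso.refl _) (fun {X Y} φ => by
    refine (Category.comp_id _).trans (Eq.trans ?_ (Category.id_comp _).symm)
    change (res D (prodFst A B)).map φ ⊗ₘ (res D (prodSnd A B)).map (𝟙 M) =
      (res D (prodFst A B)).map φ ▷ (res D (prodSnd A B)).obj M
    rw [CategoryTheory.Functor.map_id, MonoidalCategory.tensorHom_id])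

/-- The tensor product with `M` is the external tensor product with `M` restricted along the
diagonal. -/
def tensorRightIsoExternal {A : Cat.{w, w}} (M : Diag D A) :
    tensorRight M ≅ (external (tensorMor D) A A).flip.obj M ⋙ res D (diagCat A) :=
  tensorRightIso (resRetract D (diagCat A) (prodFst A A) rfl)
      (resRetract D (diagCat A) (prodSnd A A) rfl) M ≪≫
    Functor.isoWhiskerRight (externalTensorMorIso D M).symm (res D (diagCat A))

/-- Internal homs exist at each shape. -/
theorem isLeftAdjoint_tensorRight (hD : IsDerivator D) (T : TwoVariableAdjunction (tensorMor D))
    {A : Cat.{w, w}} (M : Diag D A) : (tensorRight M).IsLeftAdjoint := by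
  have := hD.isLeftAdjoint_res (diagCat A)
  have := ((T.adjLeft A A).adj M).isLeftAdjoint
  exact Functor.isLeftAdjoint_of_iso (tensorRightIsoExternal D M).symm

end InternalHom

/-! ### Indexed symmetric monoidal derivators -/

namespace IndexedSymmetricMonoidalDerivator
open Limits MonoidalCategory Functor.LaxMonoidal Functor.Monoidal

variable {S : Type uS} [Category.{vS} S] [HasFiniteProducts S]
    (V : IndexedSymmetricMonoidalDerivator.{w, v, u} S)
    (P : IndexedHomotopyCoproducts V.toPseudofunctor)

theorem projectionFormula (hV : V.IsClosed) : V.ProjectionFormula P := by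
  intro A B f I M N
  obtain ⟨TA⟩ := hV.closed_fiber A
  obtain ⟨TB⟩ := hV.closed_fiber B
  have := isLeftAdjoint_tensorRight _ (V.monoidal A).isDerivator TA ((V.pbAt f I).obj M)
  have := isLeftAdjoint_tensorRight _ (V.monoidal B).isDerivator TB M
  exact isIso_projection (adjAt (P.adj f) (op I)) (Adjunction.ofIsLeftAdjoint (tensorRight M))
    (Adjunction.ofIsLeftAdjoint (tensorRight ((V.pbAt f I).obj M))) (V.pbTensorRight f I M)
    (fun _ => rfl) (hV.closed_pb f I M _ _) N

theorem isClosed_di (hV : V.IsClosed) (Q : IndexedHomotopyProducts V.toPseudofunctor) :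
    (V.di P).IsClosed := by
  intro (R : S) (T : S) (U : S)
  obtain ⟨t⟩ := hV.closed_fiber ((R ⨯ T) ⨯ (T ⨯ U))
  exact ⟨(t.precomp (Q.adj prod.fst) (Q.adj prod.snd)).postcomp
    ((Q.adj (middleDiag R T U)).comp (P.adj (middleProj R T U)))⟩

end IndexedSymmetricMonoidalDerivator
end IndexedDerivator

theorem mainTheorem9 {S : Type uS} [Category.{vS} S] [Limits.HasFiniteProducts S]
    (V : IndexedSymmetricMonoidalDerivator.{w, v, u} S) (hV : V.IsClosed)
    (P : IndexedHomotopyCoproducts V.toPseudofunctor)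
    (Q : IndexedHomotopyProducts V.toPseudofunctor) :
    V.ProjectionFormula P ∧ (V.di P).IsClosed ∧
      ∀ W : DerivatorBicategory.{w, v, u, uS}, W.toDerivatorBicategoryData = V.di P →
        W.IsClosed := by
  refine ⟨V.projectionFormula P hV, V.isClosed_di P hV Q, ?_⟩
  intro W hW
  rw [hW]
  exact V.isClosed_di P hV Q
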